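/- **Setting.** Let $\Omega\subset\mathbb R^4$ be open, with coordinates $(u,v,x^1,x^2)$; put $\mathcal M^\pm=\Omega\cap\{\pm v\ge 0\}$ and $\mathcal N_0=\Omega\cap\{v=0\}$. On each side $\mathcal M^\pm$ let $Q>0$ and $C^A$ ($A=1,2$) be real functions and $P^A$ complex functions, of class $C^2$ up to $\mathcal N_0$, with $P$ and $\overline P$ linearly independent; let $P_A$ be defined by $P_AP^A=0$, $P_A\overline P{}^A=1$. The null frame $$D=l^a\partial_a=\partial_u+C^A\partial_A,\qquad \Delta=n^a\partial_a=Q\,\partial_v,\qquad \delta=m^a\partial_a=P^A\partial_A ,$$ with dual covectors $n_a dx^a=du$, $l_adx^a=Q^{-1}dv$, $m_adx^a=P_BC^B\,du-P_Adx^A$, defines the metric $g_{ab}=l_an_b+n_al_b-m_a\overline m_b-\overline m_am_b$ of signature $(+,-,-,-)$; write $h_{AB}=P_A\overline P_B+\overline P_AP_B$. Assume that $C^A=0$ on $\mathcal N_0$ and that $P^A$ is continuous across the null hypersurface $\mathcal N_0$. For a quantity $f$ with one-sided limits $f^\pm$ on $\mathcal N_0$ put $[f]=f^+-f^-$. The connection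 scalars are, on each side, $\lambda=-\overline m^a\overline m^b\nabla_bn_a$, $\mu=-\overline m^am^b\nabla_bn_a$, $\alpha=\tfrac12(n^a\overline m^b\nabla_bl_a-\overline m^a\overline m^b\nabla_bm_a)$. The geometry of $\mathcal N_0$ is of *type II* if $Q$ is continuous across $\mathcal N_0$. It is of *type III* if, moreover, the covariant derivatives along the generators of $\mathcal N_0$ (hence the parallel transport) of vector fields tangent to $\mathcal N_0$, computed from the two sides, coincide. The spacetime is *plane symmetric* if $C^A\equiv0$ and $Q$, $h_{AB}$ depend only on $(u,v)$. For type II geometry the metric and the frame are continuous and piecewise $C^2$, and the curvature $R^a{}_{bcd}=\partial_c\Gamma^a_{bd}-\partial_d\Gamma^a_{bc}+\Gamma^a_{ce}\Gamma^e_{bd}-\Gamma^a_{de}\Gamma^e_{bc}$ is a distribution that may be multiplied by the metric and frame components. With $R_{bd}=R^a{}_{bad}$, the scalar curvature $R$, $S_{ab}=R_{ab}-\tfrac14Rg_{ab}$ and the Weyl tensor $C_{abcd}$, the Newman–Penrose scalars are $\Psi_0=-C(l,m,l,m)$, $\Psi_1=-C(l,m,l,n)$, $\Psi_2=-C(l,m,\overline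 m,n)$, $\Psi_3=-C(l,n,\overline m,n)$, $\Psi_4=-C(\overline m,n,\overline m,n)$, $\Phi_{00}=\tfrac12S(l,l)$, $\Phi_{01}=\overline{\Phi_{10}}=\tfrac12S(l,m)$, $\Phi_{02}=\overline{\Phi_{20}}=\tfrac12S(m,m)$, $\Phi_{11}=\tfrac14(S(l,n)+S(m,\overline m))$, $\Phi_{12}=\overline{\Phi_{21}}=\tfrac12S(n,m)$, $\Phi_{22}=\tfrac12S(n,n)$, $\Lambda=-\tfrac1{24}R$. A distribution $T$ on $\Omega$ has the *Dirac part* $\breve T=c$, with $c$ continuous on $\mathcal N_0$, if $T=r+c\,\delta_{\mathcal N_0}$ with $r$ locally integrable on $\Omega$, where $\delta_{\mathcal N_0}=\Delta\mathbf 1_{\mathcal M^+}=Q\,\delta(v)$ is the Dirac measure of $\mathcal N_0$ normalized by the frame. **Theorem 3 (Jump relations for Newman–Penrose curvature scalars).** Assume that $\mathcal N_0$ has type II geometry. Then all the Newman–Penrose curvature scalars have Dirac parts on $\mathcal N_0$, given by $$\breve\Psi_4=-[\lambda],\quad \breve\Psi_3=-[\alpha],\quad \breve\Phi_{22}=-[\mu],\quad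 \breve\Phi_{12}=-[\overline\alpha]\ \ (\text{so }\breve\Phi_{21}=-[\alpha]),$$ $$\breve\Phi_{00}=\breve\Phi_{10}=\breve\Phi_{01}=\breve\Phi_{20}=\breve\Phi_{02}=\breve\Phi_{11}=\breve\Lambda=0,\qquad \breve\Psi_2=\breve\Psi_1=\breve\Psi_0=0.$$ The geometry is of type III if and only if $[\alpha]=0$ on $\mathcal N_0$, and then in addition $\breve\Psi_3=\breve\Phi_{12}=\breve\Phi_{21}=0$. If the spacetime is plane symmetric, then the geometry is of type III and hence $\breve\Psi_3=\breve\Phi_{12}=\breve\Phi_{21}=0$. In the case of pure gravitational radiation, that is, if all components $S_{ab}$ of the trace-free Ricci tensor have Dirac part zero, then $[\mu]=0$ (as well as $[\alpha]=0$) on $\mathcal N_0$. -/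

import Mathlib

noncomputable section

namespace NullJump

open MeasureTheory
open scoped ComplexConjugate

/-- Coordinates `(u, v, x¹, x²)`, with indices `0, 1, 2, 3`. -/
abbrev Coord := Fin 4 → ℝ

/-- The two sides of the hypersurface `v = 0`. -/
inductive Side
  | minus
  | plus

/-- The closed half-space `v ≤ 0`, respectively `v ≥ 0`. -/
def half : Side → Set Coord
  | .minus => {x | x 1 ≤ 0}
  | .plus => {x | 0 ≤ x 1}

/-- A function of the two sides, as one function defined off `v = 0`
(the value on the null set `v = 0` is the one of the side `+`). -/
def glue {β : Type*} (f : Side → Coord → β) (x : Coord) : β :=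
  if 0 ≤ x 1 then f .plus x else f .minus x

/-- Partial derivative in the direction `c`, taken from within one side (so one-sided at `v = 0`). -/
def pd {E : Type*} [NormedAddCommGroup E] [NormedSpace ℝ E]
    (s : Side) (f : Coord → E) (c : Fin 4) (x : Coord) : E :=
  fderivWithin ℝ f (half s) x (Pi.single c 1)

/-- The jump `[f] = f⁺ - f⁻`. -/
def jump {E : Type*} [Sub E] (f : Side → Coord → E) (x : Coord) : E :=
  f .plus x - f .minus x

/-- A spacetime `M = M⁻ ∪ M⁺` that may be singular across the null hypersurface `v = 0`, given in
the double-null coordinates `(u, v, x¹, x²)` adapted to the hypersurface, through the null frame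
`D = ∂_u + C^A ∂_A`, `Δ = Q ∂_v`, `δ = P^A ∂_A`. On each of the two sides the coefficients are
regular up to the hypersurface. Across it, `P^A` is continuous and `C^A = 0`; the coefficient `Q`
is allowed to jump (geometry of type I). -/
structure Spacetime where
  /-- the coordinate domain -/
  Ω : Set Coord
  isOpen_Ω : IsOpen Ω
  Q : Side → Coord → ℝ
  C : Side → Fin 2 → Coord → ℝ
  P : Side → Fin 2 → Coord → ℂ
  regular_Q : ∀ s, ContDiffOn ℝ 2 (Q s) (Ω ∩ half s)
  regular_C : ∀ s A, ContDiffOn ℝ 2 (C s A) (Ω ∩ half s)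
  regular_P : ∀ s A, ContDiffOn ℝ 2 (P s A) (Ω ∩ half s)
  Q_pos : ∀ s, ∀ x ∈ Ω ∩ half s, 0 < Q s x
  /-- `P` and its conjugate are linearly independent -/
  P_indep : ∀ s, ∀ x ∈ Ω ∩ half s, P s 0 x * conj (P s 1 x) - P s 1 x * conj (P s 0 x) ≠ 0
  C_eq_zero : ∀ s A, ∀ x ∈ Ω, x 1 = 0 → C s A x = 0
  P_match : ∀ A, ∀ x ∈ Ω, x 1 = 0 → P .plus A x = P .minus A x

namespace Spacetime

variable (M : Spacetime)

/-- One of the two parts `M⁻`, `M⁺` (a manifold with boundary). -/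
def part (s : Side) : Set Coord := M.Ω ∩ half s

/-- The hypersurface `N₀ = {v = 0}`. -/
def N0 : Set Coord := {x | x ∈ M.Ω ∧ x 1 = 0}

/-! ### The null tetrad and the metric -/

/-- The covector `P_A`, determined by `P_A P^A = 0` and `P_A conj(P^A) = 1`. -/
def PLow (s : Side) (A : Fin 2) (x : Coord) : ℂ :=
  ![-M.P s 1 x, M.P s 0 x] A / (M.P s 0 x * conj (M.P s 1 x) - M.P s 1 x * conj (M.P s 0 x))

theorem PLow_contract (s : Side) (x : Coord) (hx : x ∈ M.part s) :
    ∑ A, M.PLow s A x * M.P s A x = 0 ∧ ∑ A, M.PLow s A x * conj (M.P s A x) = 1 := by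
  have h := M.P_indep s x hx
  constructor
  · simp only [PLow, Fin.sum_univ_two, Matrix.cons_val_zero, Matrix.cons_val_one]
    ring
  · simp only [PLow, Fin.sum_univ_two, Matrix.cons_val_zero, Matrix.cons_val_one]
    rw [div_mul_eq_mul_div, div_mul_eq_mul_div, ← add_div, div_eq_one_iff_eq h]
    ring

/-- The induced metric `h_{AB} = 2 P_{(A} conj(P)_{B)}` on the two-surfaces of constant `u, v`. -/
def hLow (s : Side) (A B : Fin 2) (x : Coord) : ℝ :=
  2 * (M.PLow s A x * conj (M.PLow s B x)).re

/-- `l^a`, that is `D = ∂_u + C^A ∂_A`. -/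
def lUp (s : Side) (a : Fin 4) (x : Coord) : ℂ := ![1, 0, (M.C s 0 x : ℂ), (M.C s 1 x : ℂ)] a

/-- `n^a`, that is `Δ = Q ∂_v`. -/
def nUp (s : Side) (a : Fin 4) (x : Coord) : ℂ := ![0, (M.Q s x : ℂ), 0, 0] a

/-- `m^a`, that is `δ = P^A ∂_A`. -/
def mUp (s : Side) (a : Fin 4) (x : Coord) : ℂ := ![0, 0, M.P s 0 x, M.P s 1 x] a

/-- The conjugate of `m^a`. -/
def mbUp (s : Side) (a : Fin 4) (x : Coord) : ℂ := conj (M.mUp s a x)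

/-- `l_a dx^a = Q⁻¹ dv`. -/
def lLow (s : Side) (a : Fin 4) (x : Coord) : ℂ := ![0, ((M.Q s x)⁻¹ : ℂ), 0, 0] a

/-- `n_a dx^a = du`. -/
def nLow (a : Fin 4) (_x : Coord) : ℂ := ![1, 0, 0, 0] a

/-- `m_a dx^a = P_B C^B du - P_A dx^A`. -/
def mLow (s : Side) (a : Fin 4) (x : Coord) : ℂ :=
  ![∑ B, M.PLow s B x * (M.C s B x : ℂ), 0, -M.PLow s 0 x, -M.PLow s 1 x] a

/-- The metric `g_{ab} = l_a n_b + n_a l_b - m_a conj(m_b) - conj(m_a) m_b`, of signature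
`(+,-,-,-)`; the right-hand side is real. -/
def g (s : Side) (a b : Fin 4) (x : Coord) : ℝ :=
  (M.lLow s a x * nLow b x + nLow a x * M.lLow s b x
    - M.mLow s a x * conj (M.mLow s b x) - conj (M.mLow s a x) * M.mLow s b x).re

/-- The inverse metric `g^{ab} = l^a n^b + n^a l^b - m^a conj(m^b) - conj(m^a) m^b`. -/
def gInv (s : Side) (a b : Fin 4) (x : Coord) : ℝ :=
  (M.lUp s a x * M.nUp s b x + M.nUp s a x * M.lUp s b x
    - M.mUp s a x * conj (M.mUp s b x) - conj (M.mUp s a x) * M.mUp s b x).re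

/-! ### One-sided connection and Newman–Penrose connection scalars -/

/-- Christoffel symbols `Γ^a_{bc}` of one side, up to and including the boundary `v = 0`. -/
def chr (s : Side) (a b c : Fin 4) (x : Coord) : ℝ :=
  (1 / 2) * ∑ d, M.gInv s a d x *
    (pd s (M.g s d c) b x + pd s (M.g s d b) c x - pd s (M.g s b c) d x)

/-- `∇_b ω_a`. -/
def cov (s : Side) (ω : Fin 4 → Coord → ℂ) (a b : Fin 4) (x : Coord) : ℂ :=
  pd s (ω a) b x - ∑ c, (M.chr s c b a x : ℂ) * ω c x

/-- `λ = - conj(m)^a conj(m)^b ∇_b n_a`. -/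
def lam (s : Side) (x : Coord) : ℂ :=
  -∑ a, ∑ b, M.mbUp s a x * M.mbUp s b x * M.cov s nLow a b x

/-- `μ = - conj(m)^a m^b ∇_b n_a`. -/
def mu (s : Side) (x : Coord) : ℂ :=
  -∑ a, ∑ b, M.mbUp s a x * M.mUp s b x * M.cov s nLow a b x

/-- `α = (n^a conj(m)^b ∇_b l_a - conj(m)^a conj(m)^b ∇_b m_a) / 2`. -/
def alpha (s : Side) (x : Coord) : ℂ :=
  (1 / 2) * ∑ a, ∑ b, (M.nUp s a x * M.mbUp s b x * M.cov s (M.lLow s) a b x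
    - M.mbUp s a x * M.mbUp s b x * M.cov s (M.mLow s) a b x)

/-! ### Geometries of the null hypersurface -/

/-- Type II geometry: `Q` is continuous across `N₀`. -/
def TypeII : Prop := ∀ x ∈ M.N0, M.Q .plus x = M.Q .minus x

/-- The covariant derivative, computed on the side `s`, of a vector field `X` along the generator
`t ↦ (t, 0, y¹, y²)` of `N₀`. -/
def genCovDeriv (s : Side) (y : Fin 2 → ℝ) (X : ℝ → Coord) (t : ℝ) (a : Fin 4) : ℝ :=
  deriv (fun t' => X t' a) t + ∑ b, M.chr s a 0 b ![t, 0, y 0, y 1] * X t b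

/-- Type III geometry: besides type II, the parallel transport, along the generators of `N₀`, of
the vectors tangent to `N₀` is the same for both sides. -/
def TypeIII : Prop :=
  M.TypeII ∧ ∀ (y : Fin 2 → ℝ) (X : ℝ → Coord), Differentiable ℝ X → (∀ t, X t 1 = 0) →
    ∀ t, ![t, 0, y 0, y 1] ∈ M.N0 → M.genCovDeriv .plus y X t = M.genCovDeriv .minus y X t

/-- Plane symmetry: `C^A = 0`, and the metric coefficients `Q`, `h_{AB}` depend on `u, v` only. -/
def PlaneSymmetric : Prop :=
  ∀ s, (∀ A, ∀ x ∈ M.part s, M.C s A x = 0) ∧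
    ∀ x ∈ M.part s, ∀ y ∈ M.part s, x 0 = y 0 → x 1 = y 1 →
      M.Q s x = M.Q s y ∧ ∀ A B, M.hLow s A B x = M.hLow s A B y

/-! ### The distributional curvature

The metric is piecewise regular, and continuous for type II geometries. The curvature is then the
distribution obtained from the (possibly discontinuous) Christoffel symbols; its components may be
tested against, and multiplied by, continuous and piecewise regular functions. -/

/-- Linear functionals of (continuous, piecewise regular) test functions. -/
abbrev Functional := (Coord → ℂ) → ℂ

/-- The product of a function and a distribution, `⟨f T, χ⟩ = ⟨T, f χ⟩`. -/
def act (f : Coord → ℂ) (T : Functional) : Functional := fun χ => T (fun x => f x * χ x)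

/-- `R^a_{bcd} = ∂_c Γ^a_{bd} - ∂_d Γ^a_{bc} + Γ^a_{ce} Γ^e_{bd} - Γ^a_{de} Γ^e_{bc}` as a
distribution: the outer derivatives are put on the test function. -/
def riem (a b c d : Fin 4) : Functional := fun χ =>
  ∫ x, (-((glue (fun s => M.chr s a b d) x : ℝ) : ℂ) * fderiv ℝ χ x (Pi.single c 1)
    + ((glue (fun s => M.chr s a b c) x : ℝ) : ℂ) * fderiv ℝ χ x (Pi.single d 1)
    + ((glue (fun s x => ∑ e, (M.chr s a c e x * M.chr s e b d x
        - M.chr s a d e x * M.chr s e b c x)) x : ℝ) : ℂ) * χ x)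

/-- The metric on `M⁻ ∪ M⁺`. -/
def gG (a b : Fin 4) (x : Coord) : ℂ := ((glue (fun s => M.g s a b) x : ℝ) : ℂ)

/-- The inverse metric on `M⁻ ∪ M⁺`. -/
def gInvG (a b : Fin 4) (x : Coord) : ℂ := ((glue (fun s => M.gInv s a b) x : ℝ) : ℂ)

/-- `l^a` on `M⁻ ∪ M⁺`. -/
def l (a : Fin 4) : Coord → ℂ := glue (fun s => M.lUp s a)

/-- `n^a` on `M⁻ ∪ M⁺`. -/
def n (a : Fin 4) : Coord → ℂ := glue (fun s => M.nUp s a)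

/-- `m^a` on `M⁻ ∪ M⁺`. -/
def m (a : Fin 4) : Coord → ℂ := glue (fun s => M.mUp s a)

/-- The conjugate of `m^a` on `M⁻ ∪ M⁺`. -/
def mb (a : Fin 4) : Coord → ℂ := glue (fun s => M.mbUp s a)

/-- `R_{abcd} = g_{ae} R^e_{bcd}`. -/
def riemLow (a b c d : Fin 4) : Functional := ∑ e, act (M.gG a e) (M.riem e b c d)

/-- `R_{bd} = R^a_{bad}`. -/
def ricci (b d : Fin 4) : Functional := ∑ a, M.riem a b a d

/-- The scalar curvature `g^{bd} R_{bd}`. -/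
def scal : Functional := ∑ b, ∑ d, act (M.gInvG b d) (M.ricci b d)

/-- The trace-free Ricci tensor `R_{ab} - R g_{ab} / 4`. -/
def tfRicci (a b : Fin 4) : Functional :=
  M.ricci a b - (1 / 4 : ℂ) • act (M.gG a b) M.scal

/-- The Weyl tensor `C_{abcd}`. -/
def weyl (a b c d : Fin 4) : Functional :=
  M.riemLow a b c d
    - (1 / 2 : ℂ) • (act (M.gG a c) (M.ricci b d) - act (M.gG a d) (M.ricci b c)
        - act (M.gG b c) (M.ricci a d) + act (M.gG b d) (M.ricci a c))
    + (1 / 6 : ℂ) • act (fun x => M.gG a c x * M.gG b d x - M.gG a d x * M.gG b c x) M.scal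

/-- `C_{abcd} X^a Y^b Z^c W^d`. -/
def weylC (X Y Z W : Fin 4 → Coord → ℂ) : Functional :=
  ∑ a, ∑ b, ∑ c, ∑ d, act (fun x => X a x * Y b x * Z c x * W d x) (M.weyl a b c d)

/-- The contraction of the trace-free Ricci tensor with `X^a Y^b`. -/
def tfRicciC (X Y : Fin 4 → Coord → ℂ) : Functional :=
  ∑ a, ∑ b, act (fun x => X a x * Y b x) (M.tfRicci a b)

/-! The Newman–Penrose curvature scalars. With the sign of the curvature tensor used above, the
signs below are those of the Newman–Penrose equations (such as
`D ρ = ρ² + σ conj(σ) + (ε + conj(ε)) ρ + Φ₀₀` and `D σ = (ρ + conj(ρ) + 3 ε - conj(ε)) σ + Ψ₀`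
for `κ = 0`). -/

def Psi0 : Functional := -M.weylC M.l M.m M.l M.m
def Psi1 : Functional := -M.weylC M.l M.m M.l M.n
def Psi2 : Functional := -M.weylC M.l M.m M.mb M.n
def Psi3 : Functional := -M.weylC M.l M.n M.mb M.n
def Psi4 : Functional := -M.weylC M.mb M.n M.mb M.n

def Phi00 : Functional := (1 / 2 : ℂ) • M.tfRicciC M.l M.l
def Phi01 : Functional := (1 / 2 : ℂ) • M.tfRicciC M.l M.m
def Phi02 : Functional := (1 / 2 : ℂ) • M.tfRicciC M.m M.m
def Phi10 : Functional := (1 / 2 : ℂ) • M.tfRicciC M.l M.mb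
def Phi11 : Functional := (1 / 4 : ℂ) • (M.tfRicciC M.l M.n + M.tfRicciC M.m M.mb)
def Phi12 : Functional := (1 / 2 : ℂ) • M.tfRicciC M.n M.m
def Phi20 : Functional := (1 / 2 : ℂ) • M.tfRicciC M.mb M.mb
def Phi21 : Functional := (1 / 2 : ℂ) • M.tfRicciC M.n M.mb
def Phi22 : Functional := (1 / 2 : ℂ) • M.tfRicciC M.n M.n

def Lambda : Functional := -((1 / 24 : ℂ) • M.scal)

/-! ### Dirac measure parts -/

/-- The point `(u, 0, x¹, x²)` of the hypersurface `v = 0`. -/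
def onN0 (y : Fin 3 → ℝ) : Coord := ![y 0, 0, y 1, y 2]

/-- `T = r + c δ_{N₀}` with a locally integrable function `r` and a continuous function `c` on
`N₀`. Here `δ_{N₀} = Δ H = Q δ(v)` is the Dirac measure of `N₀` normalized by the frame (`H` is the
characteristic function of `M⁺`), so that `Δ f` has the Dirac coefficient `[f]`. It is meant for
type II geometries, where `Q⁺ = Q⁻` on `N₀`. -/
def HasDiracPart (T : Functional) (c : Coord → ℂ) : Prop :=
  ContinuousOn c M.N0 ∧
    ∃ r : Coord → ℂ, LocallyIntegrableOn r M.Ω ∧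
      ∀ φ : Coord → ℂ, ContDiff ℝ (⊤ : ℕ∞) φ → HasCompactSupport φ → tsupport φ ⊆ M.Ω →
        T φ = (∫ x, r x * φ x) +
          ∫ y : Fin 3 → ℝ, (M.Q .plus (onN0 y) : ℂ) * c (onN0 y) * φ (onN0 y)

/-- Pure gravitational radiation: the trace-free Ricci tensor has no Dirac measure term. -/
def PureGravitationalRadiation : Prop := ∀ a b, M.HasDiracPart (M.tfRicci a b) 0

end Spacetime

end NullJump

end

/-!
The curvature is tested against continuous, piecewise `C¹` functions of compact support
(`Spacetime.IsTest`), a class that contains the smooth test functions and is stable under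
multiplication by the components of the metric and of the frame. For such a test function,
integration by parts on each of the two half-spaces shows that the distributional derivative
`∂_c` of a piecewise `C¹` function `F` is its pointwise derivative plus the measure on the wall
`v = 0` with density `[F] k_c`, where `k = dv` (`IsTest.integral_glue_mul_fderiv`). Hence
`R^a_{bcd}` has the singular part `k_c [Γ^a_{bd}] - k_d [Γ^a_{bc}]` (`hasSingularPart_riem`), and
the singular parts of all contractions are the corresponding contractions of this tensor on the
wall, since the factors are continuous there.

What remains is algebra at a point of the wall. For type II geometry the metric is continuous, so
only its `v`-derivative jumps; with `γ_{ab} = [∂_v g_{ab}]` the lowered singular part of the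
curvature is
`(k_b k_c γ_{ad} - k_a k_c γ_{bd} - k_b k_d γ_{ac} + k_a k_d γ_{bc}) / 2` (`riemLowSing_eq`).
This does not change if a tensor `k_a w_b + w_a k_b` is added to `γ`, so the components `γ_{1a}`
play no role; and `γ₀₀ = 0` because `g₀₀` is quadratic in `C^A`, which vanishes on the wall. As `k`
is proportional to `l_a`, it annihilates `l`, `m` and `conj m`, so a frame component of the
singular curvature is nonzero only if each of its two antisymmetric pairs contains `n`. The
scalar curvature and `R(l, n)` are then proportional to `γ₀₀`, and only `R(n, n)`, `R(n, m)` and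
`R(n, conj m)` remain of the Ricci tensor. Thus `Ψ₄` and `Φ₂₂` see the contractions of `γ` with
`conj m, conj m` and with `m, conj m`, while `Ψ₃` and `Φ₂₁` see the one with `l, conj m`. Up to
factors, these contractions are the jumps of `λ`, `μ` and `α`.

The jump of the covariant derivative along the generators is `-Q γ_{0A} X^A / 2` in the direction
`∂_u`. It vanishes for all tangent `X` exactly if `γ_{0A} = 0`, that is, if `[α] = 0`; plane
symmetry gives `g_{0A} = 0` outright. For pure gravitational radiation, the Dirac part of a
distribution is unique (`HasSingularPart.eq_zero`: squeezing test functions onto the wall removes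
the locally integrable part), so that the singular part of the Ricci tensor vanishes.
-/

noncomputable section

namespace NullJump

open MeasureTheory
open scoped ComplexConjugate Topology
open Spacetime (onN0)

/-! ### Calculus on the two half-spaces -/

theorem isClosed_half (s : Side) : IsClosed (half s) := by
  cases s
  · exact isClosed_le (continuous_apply 1) continuous_const
  · exact isClosed_le continuous_const (continuous_apply 1)

theorem measurableSet_half (s : Side) : MeasurableSet (half s) := (isClosed_half s).measurableSet

theorem uniqueDiffOn_half (s : Side) : UniqueDiffOn ℝ (half s) := by
  have hlin : IsLinearMap ℝ (fun x : Coord => x 1) := ⟨fun _ _ => rfl, fun _ _ => rfl⟩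
  cases s
  · refine uniqueDiffOn_convex (convex_halfSpace_le hlin 0) ⟨fun _ => -1, ?_⟩
    refine mem_interior.2 ⟨{x | x 1 < 0}, fun x hx => le_of_lt (Set.mem_ofPred.1 hx),
      isOpen_lt (continuous_apply 1) continuous_const, ?_⟩
    simp
  · refine uniqueDiffOn_convex (convex_halfSpace_ge hlin 0) ⟨fun _ => 1, ?_⟩
    refine mem_interior.2 ⟨{x | 0 < x 1}, fun x hx => le_of_lt (Set.mem_ofPred.1 hx),
      isOpen_lt continuous_const (continuous_apply 1), ?_⟩
    simp

theorem mem_half_of_eq_zero (s : Side) {x : Coord} (hx : x 1 = 0) : x ∈ half s := by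
  cases s <;> simp [half, hx]

theorem volume_wall : volume {x : Coord | x 1 = 0} = 0 :=
  Measure.pi_hyperplane (fun _ : Fin 4 => (volume : Measure ℝ)) 1 0

theorem ae_ne_wall : ∀ᵐ x : Coord, x 1 ≠ 0 := by
  rw [ae_iff]
  simpa using volume_wall

theorem glue_eq_of_match {β : Type*} {f : Side → Coord → β} {x : Coord} (s : Side)
    (hx : x ∈ half s) (h : x 1 = 0 → f .plus x = f .minus x) : glue f x = f s x := by
  cases s
  · rcases lt_or_eq_of_le (show x 1 ≤ 0 from hx) with h' | h'
    · simp [glue, not_le.2 h']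
    · simp [glue, h', h h']
  · simp [glue, show 0 ≤ x 1 from hx]

theorem glue_eq_of_ne {β : Type*} {f : Side → Coord → β} {x : Coord} (s : Side)
    (hx : x ∈ half s) (h : x 1 ≠ 0) : glue f x = f s x :=
  glue_eq_of_match s hx fun h' => absurd h' h

theorem glue_of_nonneg {β : Type*} {f : Side → Coord → β} {x : Coord} (hx : 0 ≤ x 1) :
    glue f x = f .plus x := if_pos hx

theorem integral_eq_add_half {f : Coord → ℂ} (hf : Integrable f) :
    ∫ x, f x = (∫ x in half .plus, f x) + ∫ x in half .minus, f x := by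
  rw [← integral_add_compl (measurableSet_half .plus) hf]
  congr 1
  apply setIntegral_congr_set
  filter_upwards [ae_ne_wall] with x hx
  apply propext
  change ¬ (0 ≤ x 1) ↔ x 1 ≤ 0
  rw [not_le]
  exact ⟨le_of_lt, fun h => lt_of_le_of_ne h hx⟩

theorem integrable_of_half {f : Coord → ℂ} (hf : ∀ s, IntegrableOn f (half s)) :
    Integrable f := by
  have h := (hf .plus).union (hf .minus)
  have hu : half .plus ∪ half .minus = Set.univ := by
    ext x
    simpa [half] using le_total 0 (x 1)
  rwa [hu, integrableOn_univ] at h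

theorem integrableOn_of_continuousOn_inter {X : Type*} [TopologicalSpace X] [T2Space X]
    [MeasurableSpace X] [OpensMeasurableSpace X]
    {μ : Measure X} [IsFiniteMeasureOnCompacts μ] {f : X → ℂ} {S K : Set X} (hS : IsClosed S)
    (hK : IsCompact K) (hf : ContinuousOn f (S ∩ K)) (h0 : ∀ x ∈ S, x ∉ K → f x = 0) :
    IntegrableOn f S μ := by
  have h1 : IntegrableOn f (S ∩ K) μ := hf.integrableOn_compact (hK.inter_left hS)
  exact h1.of_forall_sdiff_eq_zero hS.measurableSet fun x hx =>
    h0 x hx.1 fun hxK => hx.2 ⟨hx.1, hxK⟩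

section Pd

variable {E : Type*} [NormedAddCommGroup E] [NormedSpace ℝ E]

theorem pd_eq_zero_of_notMem_tsupport {s : Side} {f : Coord → E} {c : Fin 4} {x : Coord}
    (hx : x ∉ tsupport f) : pd s f c x = 0 := by
  have h : f =ᶠ[𝓝[half s] x] fun _ => 0 :=
    (notMem_tsupport_iff_eventuallyEq.1 hx).filter_mono nhdsWithin_le_nhds
  have h0 : f x = 0 := image_eq_zero_of_notMem_tsupport hx
  simp [pd, h.fderivWithin_eq h0]

theorem pd_eq_of_eqOn {s : Side} {f g : Coord → E} {U : Set Coord} (hU : IsOpen U)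
    (h : Set.EqOn f g (U ∩ half s)) (c : Fin 4) {x : Coord} (hx : x ∈ U ∩ half s) :
    pd s f c x = pd s g c x := by
  have h' : f =ᶠ[𝓝[half s] x] g := by
    filter_upwards [self_mem_nhdsWithin, mem_nhdsWithin_of_mem_nhds (hU.mem_nhds hx.1)]
      with y hy hyU using h ⟨hyU, hy⟩
  simp [pd, h'.fderivWithin_eq (h hx)]

theorem pd_eq_fderivWithin_inter {s : Side} {f : Coord → E} {U : Set Coord} (hU : IsOpen U)
    (c : Fin 4) {x : Coord} (hx : x ∈ U) :
    pd s f c x = fderivWithin ℝ f (U ∩ half s) x (Pi.single c 1) := by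
  rw [pd, Set.inter_comm, fderivWithin_inter (hU.mem_nhds hx)]

theorem pd_eq_fderiv {s : Side} {f : Coord → E} (c : Fin 4) {x : Coord} (hx : x ∈ half s)
    (h0 : x 1 ≠ 0) : pd s f c x = fderiv ℝ f x (Pi.single c 1) := by
  have : half s ∈ 𝓝 x := by
    cases s
    · exact Filter.mem_of_superset ((isOpen_lt (continuous_apply 1) continuous_const).mem_nhds
        (lt_of_le_of_ne hx h0)) fun y hy => le_of_lt (Set.mem_ofPred.1 hy)
    · exact Filter.mem_of_superset ((isOpen_lt continuous_const (continuous_apply 1)).mem_nhds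
        (lt_of_le_of_ne hx (Ne.symm h0))) fun y hy => le_of_lt (Set.mem_ofPred.1 hy)
  rw [pd, fderivWithin_of_mem_nhds this]

theorem contDiffOn_pd {s : Side} {f : Coord → E} {U : Set Coord} (hU : IsOpen U)
    {k k' : WithTop ℕ∞} (hf : ContDiffOn ℝ k' f (U ∩ half s)) (hk : k + 1 ≤ k') (c : Fin 4) :
    ContDiffOn ℝ k (pd s f c) (U ∩ half s) := by
  have hu : UniqueDiffOn ℝ (U ∩ half s) := by
    rw [Set.inter_comm]; exact (uniqueDiffOn_half s).inter hU
  exact ((hf.fderivWithin hu hk).clm_apply contDiffOn_const).congr fun x hx =>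
    pd_eq_fderivWithin_inter hU c hx.1

theorem differentiableWithinAt_half {s : Side} {f : Coord → E} {U : Set Coord} (hU : IsOpen U)
    {k : WithTop ℕ∞} (hf : ContDiffOn ℝ k f (U ∩ half s)) (hk : k ≠ 0) {x : Coord}
    (hx : x ∈ U ∩ half s) : DifferentiableWithinAt ℝ f (half s) x := by
  have h := hf.differentiableOn hk x hx
  rw [Set.inter_comm] at h
  exact (differentiableWithinAt_inter (hU.mem_nhds hx.1)).1 h

theorem pd_mul {s : Side} {f g : Coord → ℂ} (c : Fin 4) {x : Coord} (hx : x ∈ half s)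
    (hf : DifferentiableWithinAt ℝ f (half s) x) (hg : DifferentiableWithinAt ℝ g (half s) x) :
    pd s (fun y => f y * g y) c x = pd s f c x * g x + f x * pd s g c x := by
  simp only [pd]
  rw [fderivWithin_fun_mul (uniqueDiffOn_half s x hx) hf hg]
  simp [mul_comm, add_comm]

/-- Derivatives tangential to the wall do not see the side, for a function continuous across it. -/
theorem pd_tangential_eq {f : Side → Coord → E} {U : Set Coord} (hU : IsOpen U)
    (hf : ∀ s, ContDiffOn ℝ 1 (f s) (U ∩ half s))
    (hm : ∀ x ∈ U, x 1 = 0 → f .plus x = f .minus x) {c : Fin 4} (hc : c ≠ 1) {x : Coord}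
    (hx : x ∈ U) (hx0 : x 1 = 0) : pd .plus (f .plus) c x = pd .minus (f .minus) c x := by
  have hline : ∀ t : ℝ, (Function.update x c t) 1 = 0 := fun t => by
    rw [Function.update_of_ne hc.symm, hx0]
  have key : ∀ s, HasDerivAt (fun t => f s (Function.update x c t)) (pd s (f s) c x) (x c) := by
    intro s
    have h1 := (differentiableWithinAt_half hU (hf s) one_ne_zero
      ⟨hx, mem_half_of_eq_zero s hx0⟩).hasFDerivWithinAt
    have h2 := (hasDerivAt_update x c (x c)).hasDerivWithinAt (s := Set.univ)
    rw [← Function.update_eq_self c x] at h1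
    have h3 := HasFDerivWithinAt.comp_hasDerivWithinAt (x c) h1 h2
      (fun t _ => mem_half_of_eq_zero s (hline t))
    rw [Function.update_eq_self c x] at h3
    exact h3.hasDerivAt Filter.univ_mem
  refine (key .plus).unique ((key .minus).congr_of_eventuallyEq ?_)
  have hcont : Continuous fun t : ℝ => Function.update x c t := by fun_prop
  have : ∀ᶠ t in 𝓝 (x c), Function.update x c t ∈ U := by
    apply hcont.continuousAt.eventually_mem
    rw [Function.update_eq_self]
    exact hU.mem_nhds hx
  filter_upwards [this] with t ht using hm _ ht (hline t)

end Pd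

/-! ### The divergence theorem on a half-space -/

theorem onN0_eq_insertNth (y : Fin 3 → ℝ) :
    onN0 y = Fin.insertNth (α := fun _ => ℝ) 1 0 y := by
  funext i
  fin_cases i <;> rfl

theorem continuous_onN0 : Continuous onN0 := by
  unfold onN0
  fun_prop

theorem onN0_one (y : Fin 3 → ℝ) : onN0 y 1 = 0 := rfl

theorem integral_eq_integral_insertNth (c : Fin 4) {F : Coord → ℂ} (hF : Integrable F) :
    ∫ x, F x = ∫ z : Fin 3 → ℝ, ∫ t : ℝ, F (Fin.insertNth (α := fun _ => ℝ) c t z) := by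
  have hmp := (volume_preserving_piFinSuccAbove (fun _ : Fin 4 => ℝ) c).symm
  rw [← hmp.integral_comp' F]
  have hi : Integrable (fun p : ℝ × (Fin 3 → ℝ) =>
      F ((MeasurableEquiv.piFinSuccAbove (fun _ : Fin 4 => ℝ) c).symm p)) volume :=
    hmp.integrable_comp_of_integrable hF
  exact integral_prod_symm _ hi

/-- The `v`-component of the outward unit normal of a side at the wall. -/
def outward : Side → ℂ
  | .minus => 1
  | .plus => -1

section Divergence

variable {s : Side} {f : Coord → ℂ}

theorem continuousOn_pd_half (hf : ContDiffOn ℝ 1 f (half s)) (c : Fin 4) :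
    ContinuousOn (pd s f c) (half s) := by
  have := contDiffOn_pd (U := Set.univ) (s := s) (f := f) isOpen_univ (k := 0) (k' := 1)
    (by simpa using hf) (by simp) c
  simpa using this.continuousOn

theorem integrableOn_pd (hf : ContDiffOn ℝ 1 f (half s)) (hc : HasCompactSupport f)
    (c : Fin 4) : IntegrableOn (pd s f c) (half s) :=
  integrableOn_of_continuousOn_inter (isClosed_half s) hc
    ((continuousOn_pd_half hf c).mono Set.inter_subset_left)
    fun _ _ hx => pd_eq_zero_of_notMem_tsupport hx

/-- The coordinate line through `z` in the direction `c`. -/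
def line (c : Fin 4) (z : Fin 3 → ℝ) (t : ℝ) : Coord := Fin.insertNth (α := fun _ => ℝ) c t z

theorem line_eq_update (c : Fin 4) (z : Fin 3 → ℝ) :
    line c z = Function.update (line c z 0) c := by
  funext t
  simp [line]

theorem line_self (c : Fin 4) (z : Fin 3 → ℝ) (t : ℝ) : line c z t c = t := by simp [line]

theorem line_of_ne {c i : Fin 4} (h : i ≠ c) (z : Fin 3 → ℝ) (t : ℝ) :
    line c z t i = line c z 0 i := by
  rw [line_eq_update, Function.update_of_ne h]
  simp [Function.update_of_ne h]

theorem continuous_line (c : Fin 4) (z : Fin 3 → ℝ) : Continuous (line c z) := by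
  rw [line_eq_update]; fun_prop

theorem isCompact_line_preimage (c : Fin 4) (z : Fin 3 → ℝ) {K : Set Coord} (hK : IsCompact K) :
    IsCompact (line c z ⁻¹' K) := by
  refine IsCompact.of_isClosed_subset (hK.image (continuous_apply c))
    (hK.isClosed.preimage (continuous_line c z)) fun t ht => ⟨_, ht, line_self c z t⟩

theorem hasDerivWithinAt_line (hf : ContDiffOn ℝ 1 f (half s)) (c : Fin 4)
    (z : Fin 3 → ℝ) {t : ℝ} (ht : line c z t ∈ half s) :
    HasDerivWithinAt (fun t => f (line c z t)) (pd s f c (line c z t))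
      (line c z ⁻¹' half s) t := by
  have h1 := ((hf.differentiableOn one_ne_zero) _ ht).hasFDerivWithinAt
  have h2 : HasDerivWithinAt (line c z) (Pi.single c 1) (line c z ⁻¹' half s) t := by
    rw [line_eq_update]
    exact (hasDerivAt_update _ c t).hasDerivWithinAt
  exact HasFDerivWithinAt.comp_hasDerivWithinAt t h1 h2 fun _ h => h

theorem integrableOn_pd_line (hf : ContDiffOn ℝ 1 f (half s)) (hc : HasCompactSupport f)
    (c : Fin 4) (z : Fin 3 → ℝ) :
    IntegrableOn (fun t => pd s f c (line c z t)) (line c z ⁻¹' half s) := by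
  refine integrableOn_of_continuousOn_inter ((isClosed_half s).preimage (continuous_line c z))
    (isCompact_line_preimage c z hc) ?_ fun t _ ht => pd_eq_zero_of_notMem_tsupport ht
  exact ((continuousOn_pd_half hf c).comp (continuous_line c z).continuousOn
    fun _ h => h).mono Set.inter_subset_left

theorem hasCompactSupport_line (hc : HasCompactSupport f) (c : Fin 4) (z : Fin 3 → ℝ) :
    HasCompactSupport fun t => f (line c z t) :=
  HasCompactSupport.intro (isCompact_line_preimage c z hc) fun _ ht =>
    image_eq_zero_of_notMem_tsupport ht

theorem continuousOn_comp_line (hf : ContDiffOn ℝ 1 f (half s)) (c : Fin 4) (z : Fin 3 → ℝ) :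
    ContinuousOn (fun t => f (line c z t)) (line c z ⁻¹' half s) :=
  hf.continuousOn.comp (continuous_line c z).continuousOn fun _ h => h

theorem integral_pd_line_tangential (hf : ContDiffOn ℝ 1 f (half s)) (hc : HasCompactSupport f)
    {c : Fin 4} (hc1 : c ≠ 1) (z : Fin 3 → ℝ) :
    ∫ t in line c z ⁻¹' half s, pd s f c (line c z t) = 0 := by
  have hmem : ∀ t, line c z t ∈ half s ↔ line c z 0 ∈ half s := fun t => by
    cases s <;> simp only [half, Set.mem_ofPred_eq, line_of_ne hc1.symm z t]
  by_cases h : line c z 0 ∈ half s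
  · have hu : line c z ⁻¹' half s = Set.univ :=
      Set.eq_univ_of_forall fun t => (hmem t).2 h
    have h1 := integrableOn_pd_line hf hc c z
    have h2 := continuousOn_comp_line hf c z
    rw [hu] at h1 h2 ⊢
    rw [integrableOn_univ] at h1
    rw [continuousOn_univ] at h2
    rw [setIntegral_univ]
    refine integral_eq_zero_of_hasDerivAt_of_integrable (fun t => ?_) h1
      (h2.integrable_of_hasCompactSupport (hasCompactSupport_line hc c z))
    have h3 := hasDerivWithinAt_line hf c z ((hmem t).2 h)
    rw [hu] at h3
    exact h3.hasDerivAt Filter.univ_mem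
  · have hu : line c z ⁻¹' half s = ∅ :=
      Set.eq_empty_of_forall_notMem fun t ht => h ((hmem t).1 ht)
    simp [hu]

theorem integral_pd_line_normal (hf : ContDiffOn ℝ 1 f (half s)) (hc : HasCompactSupport f)
    (z : Fin 3 → ℝ) :
    ∫ t in line 1 z ⁻¹' half s, pd s f 1 (line 1 z t) = outward s * f (onN0 z) := by
  have h1 := integrableOn_pd_line hf hc 1 z
  have h2 := continuousOn_comp_line hf 1 z
  have h3 := fun t ht => hasDerivWithinAt_line hf 1 z (t := t) ht
  have h4 := hasCompactSupport_line hc 1 z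
  rw [onN0_eq_insertNth]
  change _ = outward s * f (line 1 z 0)
  cases s
  · have hu : line 1 z ⁻¹' half .minus = Set.Iic 0 := by
      ext t
      simp [half, line_self]
    have hIio : ∀ t ∈ Set.Iio (0 : ℝ), line 1 z t ∈ half .minus := fun t ht => by
      simpa [half, line_self] using le_of_lt (Set.mem_Iio.1 ht)
    rw [hu] at h1 h2 h3 ⊢
    rw [integral_Iic_of_hasDerivAt_of_tendsto (f := fun t => f (line 1 z t)) (m := 0)
      (h2 0 (by simp)) (fun t ht => (h3 t (hIio t ht)).hasDerivAt (Iic_mem_nhds ht)) h1 ?_]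
    · simp [outward]
    · exact h4.is_zero_at_infty.mono_left atBot_le_cocompact
  · have hu : line 1 z ⁻¹' half .plus = Set.Ici 0 := by
      ext t
      simp [half, line_self]
    have hIoi : ∀ t ∈ Set.Ioi (0 : ℝ), line 1 z t ∈ half .plus := fun t ht => by
      simpa [half, line_self] using le_of_lt (Set.mem_Ioi.1 ht)
    rw [hu] at h1 h2 h3 ⊢
    rw [integral_Ici_eq_integral_Ioi,
      integral_Ioi_of_hasDerivAt_of_tendsto (f := fun t => f (line 1 z t)) (m := 0)
      (h2 0 (by simp)) (fun t ht => (h3 t (hIoi t ht)).hasDerivAt (Ici_mem_nhds ht))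
      (h1.mono_set Set.Ioi_subset_Ici_self) ?_]
    · simp [outward]
    · exact h4.is_zero_at_infty.mono_left atTop_le_cocompact

/-- The divergence theorem on a half-space, for compactly supported functions. -/
theorem integral_half_pd (hf : ContDiffOn ℝ 1 f (half s)) (hc : HasCompactSupport f)
    (c : Fin 4) :
    ∫ x in half s, pd s f c x = if c = 1 then outward s * ∫ y, f (onN0 y) else 0 := by
  have hF : Integrable ((half s).indicator (pd s f c)) :=
    (integrable_indicator_iff (measurableSet_half s)).2 (integrableOn_pd hf hc c)
  rw [← integral_indicator (measurableSet_half s), integral_eq_integral_insertNth c hF]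
  have hin : ∀ z : Fin 3 → ℝ, (∫ t : ℝ, (half s).indicator (pd s f c)
      (Fin.insertNth (α := fun _ => ℝ) c t z)) =
      ∫ t in line c z ⁻¹' half s, pd s f c (line c z t) := fun z => by
    rw [← integral_indicator (((isClosed_half s).preimage (continuous_line c z)).measurableSet)]
    rfl
  simp only [hin]
  split_ifs with h
  · subst h
    simp only [integral_pd_line_normal hf hc]
    rw [integral_const_mul]
  · simp only [integral_pd_line_tangential hf hc h, integral_zero]

end Divergence

namespace Spacetime

variable {M : Spacetime}

/-! ### Test functions -/

/-- Continuous test functions with compact support in `Ω`, continuously differentiable on each of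
the two sides up to the wall. This class contains the smooth test functions and, unlike these, is
stable under multiplication by the components of the metric and of the frame. -/
structure IsTest (M : Spacetime) (χ : Coord → ℂ) : Prop where
  continuous : Continuous χ
  hasCompactSupport : HasCompactSupport χ
  tsupport_subset : tsupport χ ⊆ M.Ω
  contDiffOn : ∀ s, ContDiffOn ℝ 1 χ (half s)

theorem isTest_of_contDiff {φ : Coord → ℂ} (h : ContDiff ℝ (⊤ : ℕ∞) φ)
    (hc : HasCompactSupport φ) (hs : tsupport φ ⊆ M.Ω) : M.IsTest φ :=
  ⟨h.continuous, hc, hs, fun _ => (h.of_le (by exact_mod_cast le_top)).contDiffOn⟩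

theorem continuousOn_of_parts {f : Coord → ℂ} (hf : ∀ s, ContinuousOn f (M.part s)) :
    ContinuousOn f M.Ω := by
  intro x hx
  have h : ∀ s, ContinuousWithinAt f (half s) x := fun s => by
    by_cases hxs : x ∈ half s
    · have := hf s x ⟨hx, hxs⟩
      rw [part, Set.inter_comm] at this
      exact (continuousWithinAt_inter (M.isOpen_Ω.mem_nhds hx)).1 this
    · have : 𝓝[half s] x = ⊥ := by
        rw [← Filter.not_neBot, ← mem_closure_iff_nhdsWithin_neBot, (isClosed_half s).closure_eq]
        exact hxs
      simp [ContinuousWithinAt, this]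
  have hu : half .plus ∪ half .minus = Set.univ := by
    ext x
    simpa [half] using le_total 0 (x 1)
  have := (h .plus).union (h .minus)
  rw [hu, continuousWithinAt_univ] at this
  exact this.continuousWithinAt

theorem IsTest.contDiffOn_mul {χ F : Coord → ℂ} (hχ : M.IsTest χ) {s : Side}
    (hF : ContDiffOn ℝ 1 F (M.part s)) : ContDiffOn ℝ 1 (fun y => F y * χ y) (half s) := by
  intro x hx
  by_cases hxΩ : x ∈ M.Ω
  · have h1 := hF x ⟨hxΩ, hx⟩
    rw [part, Set.inter_comm] at h1
    exact (h1.mul ((hχ.contDiffOn s x hx).mono Set.inter_subset_left)).mono_of_mem_nhdsWithin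
      (inter_mem_nhdsWithin _ (M.isOpen_Ω.mem_nhds hxΩ))
  · have h0 : x ∉ tsupport fun y => F y * χ y := fun h =>
      hxΩ (hχ.tsupport_subset (tsupport_mul_subset_right h))
    have h1 : (fun x => F x * χ x) =ᶠ[𝓝 x] fun _ => 0 := notMem_tsupport_iff_eventuallyEq.1 h0
    exact (contDiffAt_const.congr_of_eventuallyEq h1).contDiffWithinAt

theorem IsTest.mul_left {f χ : Coord → ℂ} (hχ : M.IsTest χ)
    (hf : ∀ s, ContDiffOn ℝ 1 f (M.part s)) : M.IsTest fun x => f x * χ x := by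
  have hsupp : tsupport (fun x => f x * χ x) ⊆ tsupport χ := tsupport_mul_subset_right
  refine ⟨continuous_of_tsupport fun x hx => ?_, hχ.hasCompactSupport.mul_left,
    hsupp.trans hχ.tsupport_subset, fun s => hχ.contDiffOn_mul (hf s)⟩
  have hxΩ := hχ.tsupport_subset (hsupp hx)
  exact ((continuousOn_of_parts fun s => (hf s).continuousOn).continuousAt
    (M.isOpen_Ω.mem_nhds hxΩ)).mul hχ.continuous.continuousAt

theorem IsTest.integrable_mul {r χ : Coord → ℂ} (hχ : M.IsTest χ)
    (hr : LocallyIntegrableOn r M.Ω) : Integrable fun x => r x * χ x := by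
  have h1 : IntegrableOn r (tsupport χ) :=
    hr.integrableOn_compact_subset hχ.tsupport_subset hχ.hasCompactSupport
  have h2 := h1.mul_continuousOn hχ.continuous.continuousOn hχ.hasCompactSupport
  refine (integrableOn_iff_integrable_of_support_subset ?_).1 h2
  exact (Function.support_mul_subset_right _ _).trans (subset_tsupport χ)

theorem isClosedEmbedding_onN0 : Topology.IsClosedEmbedding onN0 := by
  let p : Coord → (Fin 3 → ℝ) := fun x => ![x 0, x 2, x 3]
  have hp : Continuous p := by fun_prop
  have hleft : Function.LeftInverse p onN0 := fun y => by
    funext i; fin_cases i <;> rfl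
  exact hleft.isClosedEmbedding hp continuous_onN0

theorem IsTest.hasCompactSupport_onN0 {χ : Coord → ℂ} (hχ : M.IsTest χ) :
    HasCompactSupport fun y => χ (onN0 y) :=
  hχ.hasCompactSupport.comp_isClosedEmbedding isClosedEmbedding_onN0

theorem IsTest.apply_eq_zero {χ : Coord → ℂ} (hχ : M.IsTest χ) {x : Coord} (hx : x ∉ M.Ω) :
    χ x = 0 :=
  image_eq_zero_of_notMem_tsupport fun h => hx (hχ.tsupport_subset h)

theorem IsTest.continuous_wall {c χ : Coord → ℂ} (hχ : M.IsTest χ) (hc : ContinuousOn c M.N0) :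
    Continuous fun y => c (onN0 y) * χ (onN0 y) := by
  rw [continuous_iff_continuousAt]
  intro y
  by_cases hy : onN0 y ∈ tsupport χ
  · have hmem : onN0 y ∈ M.N0 := ⟨hχ.tsupport_subset hy, rfl⟩
    have hev : ∀ᶠ z in 𝓝 y, onN0 z ∈ M.N0 := by
      filter_upwards [continuous_onN0.continuousAt.eventually_mem
        (M.isOpen_Ω.mem_nhds hmem.1)] with z hz using ⟨hz, rfl⟩
    have h1 : ContinuousAt (fun z => c (onN0 z)) y :=
      (hc _ hmem).tendsto.comp (tendsto_nhdsWithin_iff.2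
        ⟨continuous_onN0.continuousAt, hev⟩)
    exact h1.mul (hχ.continuous.comp continuous_onN0).continuousAt
  · have h0 : (fun z => c (onN0 z) * χ (onN0 z)) =ᶠ[𝓝 y] fun _ => 0 := by
      filter_upwards [continuous_onN0.continuousAt.eventually
        (notMem_tsupport_iff_eventuallyEq.1 hy)] with z hz
      simp [hz]
    exact continuousAt_const.congr h0.symm

theorem IsTest.integrable_wall {c χ : Coord → ℂ} (hχ : M.IsTest χ) (hc : ContinuousOn c M.N0) :
    Integrable fun y => c (onN0 y) * χ (onN0 y) :=
  (hχ.continuous_wall hc).integrable_of_hasCompactSupport hχ.hasCompactSupport_onN0.mul_left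

theorem locallyIntegrableOn_glue {f : Side → Coord → ℂ}
    (hf : ∀ s, ContinuousOn (f s) (M.part s)) : LocallyIntegrableOn (glue f) M.Ω := by
  rw [locallyIntegrableOn_iff M.isOpen_Ω.isLocallyClosed]
  intro K hK hKc
  have h : ∀ s, IntegrableOn (glue f) (K ∩ half s) := fun s => by
    refine IntegrableOn.congr_fun_ae (((hf s).mono
      (Set.inter_subset_inter_left _ hK)).integrableOn_compact
        (hKc.inter_right (isClosed_half s))) ?_
    filter_upwards [ae_restrict_mem (hKc.measurableSet.inter (measurableSet_half s)),
      ae_restrict_of_ae ae_ne_wall] with x hx hx0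
    exact (glue_eq_of_ne s hx.2 hx0).symm
  refine ((h .plus).union (h .minus)).mono_set fun x hx => ?_
  rcases le_total 0 (x 1) with h0 | h0
  · exact Or.inl ⟨hx, h0⟩
  · exact Or.inr ⟨hx, h0⟩

/-! ### Integration by parts across the wall -/

/-- The product rule on a whole half-space: outside `Ω`, where `F` is arbitrary, both sides
vanish. -/
theorem IsTest.pd_mul {χ F : Coord → ℂ} (hχ : M.IsTest χ) {s : Side}
    (hF : ContDiffOn ℝ 1 F (M.part s)) (c : Fin 4) {x : Coord} (hx : x ∈ half s) :
    pd s (fun y => F y * χ y) c x = pd s F c x * χ x + F x * pd s χ c x := by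
  by_cases hxΩ : x ∈ M.Ω
  · exact NullJump.pd_mul c hx (differentiableWithinAt_half M.isOpen_Ω hF one_ne_zero ⟨hxΩ, hx⟩)
      ((hχ.contDiffOn s).differentiableOn one_ne_zero x hx)
  · have h0 : x ∉ tsupport χ := fun h => hxΩ (hχ.tsupport_subset h)
    have h1 : x ∉ tsupport fun y => F y * χ y := fun h => h0 (tsupport_mul_subset_right h)
    rw [pd_eq_zero_of_notMem_tsupport h0, pd_eq_zero_of_notMem_tsupport h1,
      image_eq_zero_of_notMem_tsupport h0]
    simp

theorem IsTest.integrableOn_half_mul_pd {χ F : Coord → ℂ} (hχ : M.IsTest χ) {s : Side}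
    (hF : ContinuousOn F (M.part s)) (c : Fin 4) :
    IntegrableOn (fun x => F x * pd s χ c x) (half s) := by
  refine integrableOn_of_continuousOn_inter (isClosed_half s) hχ.hasCompactSupport ?_
    fun x _ hx => by rw [pd_eq_zero_of_notMem_tsupport hx, mul_zero]
  exact (hF.mono fun x hx => ⟨hχ.tsupport_subset hx.2, hx.1⟩).mul
    ((continuousOn_pd_half (hχ.contDiffOn s) c).mono Set.inter_subset_left)

theorem glue_mul_fderiv_ae {F : Side → Coord → ℂ} (χ : Coord → ℂ) (c : Fin 4) (s : Side) :
    (fun x => F s x * pd s χ c x) =ᵐ[volume.restrict (half s)]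
      fun x => glue F x * fderiv ℝ χ x (Pi.single c 1) := by
  filter_upwards [ae_restrict_mem (measurableSet_half s), ae_restrict_of_ae ae_ne_wall]
    with x hx hx0
  rw [glue_eq_of_ne s hx hx0, pd_eq_fderiv c hx hx0]

theorem IsTest.integrable_glue_mul_fderiv {χ : Coord → ℂ} (hχ : M.IsTest χ)
    {F : Side → Coord → ℂ} (hF : ∀ s, ContinuousOn (F s) (M.part s)) (c : Fin 4) :
    Integrable fun x => glue F x * fderiv ℝ χ x (Pi.single c 1) :=
  integrable_of_half fun s =>
    (hχ.integrableOn_half_mul_pd (hF s) c).congr_fun_ae (glue_mul_fderiv_ae χ c s)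

/-- The distributional derivative of a piecewise regular function: the derivative taken on both
sides, and a measure on the wall whose density is the jump of the function. -/
theorem IsTest.integral_glue_mul_fderiv {χ : Coord → ℂ} (hχ : M.IsTest χ)
    {F : Side → Coord → ℂ} (hF : ∀ s, ContDiffOn ℝ 1 (F s) (M.part s)) (c : Fin 4) :
    -∫ x, glue F x * fderiv ℝ χ x (Pi.single c 1) =
      (∫ x, glue (fun s => pd s (F s) c) x * χ x) +
        ∫ y, (if c = 1 then jump F (onN0 y) else 0) * χ (onN0 y) := by
  have hpd : ∀ s, ContinuousOn (pd s (F s) c) (M.part s) := fun s =>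
    (contDiffOn_pd (k := 0) M.isOpen_Ω (hF s) (by simp) c).continuousOn
  have hint := hχ.integrable_glue_mul_fderiv (fun s => (hF s).continuousOn) c
  have hpi := hχ.integrable_mul (locallyIntegrableOn_glue hpd)
  have hside : ∀ s, ∫ x in half s, glue F x * fderiv ℝ χ x (Pi.single c 1) =
      (if c = 1 then outward s * ∫ y, F s (onN0 y) * χ (onN0 y) else 0) -
        ∫ x in half s, glue (fun s => pd s (F s) c) x * χ x := fun s => by
    rw [← integral_half_pd (hχ.contDiffOn_mul (hF s)) hχ.hasCompactSupport.mul_left c,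
      ← integral_sub (integrableOn_pd (hχ.contDiffOn_mul (hF s))
        hχ.hasCompactSupport.mul_left c) hpi.integrableOn]
    refine integral_congr_ae ?_
    filter_upwards [glue_mul_fderiv_ae (F := F) χ c s, ae_restrict_mem (measurableSet_half s),
      ae_restrict_of_ae ae_ne_wall] with x h1 hx hx0
    rw [← h1, hχ.pd_mul (hF s) c hx, glue_eq_of_ne s hx hx0]
    ring
  rw [integral_eq_add_half hint, integral_eq_add_half hpi, hside, hside]
  have hwall : ∀ s, Integrable fun y => F s (onN0 y) * χ (onN0 y) := fun s =>
    hχ.integrable_wall ((hF s).continuousOn.mono fun x hx =>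
      ⟨hx.1, mem_half_of_eq_zero s hx.2⟩)
  split_ifs with h
  · simp only [jump, sub_mul]
    rw [integral_sub (hwall .plus) (hwall .minus)]
    simp only [outward]
    ring
  · simp only [zero_mul, integral_zero]
    ring

/-! ### Distributions with a singular part on the wall -/

/-- `T` is the sum of a locally integrable function and the measure `c du dx¹ dx²` on the wall,
as a functional on continuous, piecewise regular test functions. The coefficient is relative to
the coordinate measure on the wall, so that it does not involve the frame. -/
def HasSingularPart (M : Spacetime) (T : Functional) (c : Coord → ℂ) : Prop :=
  ContinuousOn c M.N0 ∧ ∃ r : Coord → ℂ, LocallyIntegrableOn r M.Ω ∧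
    ∀ χ, M.IsTest χ → T χ = (∫ x, r x * χ x) + ∫ y : Fin 3 → ℝ, c (onN0 y) * χ (onN0 y)

namespace HasSingularPart

variable {T T' : Functional} {c c' : Coord → ℂ}

theorem add (h : M.HasSingularPart T c) (h' : M.HasSingularPart T' c') :
    M.HasSingularPart (T + T') (fun x => c x + c' x) := by
  obtain ⟨hc, r, hr, h⟩ := h
  obtain ⟨hc', r', hr', h'⟩ := h'
  refine ⟨hc.add hc', r + r', hr.add hr', fun χ hχ => ?_⟩
  simp only [Pi.add_apply, add_mul]
  rw [integral_add (hχ.integrable_mul hr) (hχ.integrable_mul hr'),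
    integral_add (hχ.integrable_wall hc) (hχ.integrable_wall hc'), h χ hχ, h' χ hχ]
  ring

theorem smul (h : M.HasSingularPart T c) (k : ℂ) :
    M.HasSingularPart (k • T) (fun x => k * c x) := by
  obtain ⟨hc, r, hr, h⟩ := h
  refine ⟨continuousOn_const.mul hc, k • r, hr.smul k, fun χ hχ => ?_⟩
  simp only [Pi.smul_apply, smul_eq_mul, mul_assoc]
  rw [integral_const_mul, integral_const_mul, h χ hχ]
  ring

theorem neg (h : M.HasSingularPart T c) : M.HasSingularPart (-T) (fun x => -c x) := by
  simpa using h.smul (-1)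

theorem sub (h : M.HasSingularPart T c) (h' : M.HasSingularPart T' c') :
    M.HasSingularPart (T - T') (fun x => c x - c' x) := by
  simpa [sub_eq_add_neg] using h.add h'.neg

theorem zero : M.HasSingularPart 0 (fun _ => 0) :=
  ⟨continuousOn_const, 0, locallyIntegrableOn_zero, fun χ _ => by simp⟩

theorem sum {ι : Type*} (t : Finset ι) {T : ι → Functional} {c : ι → Coord → ℂ}
    (h : ∀ i, M.HasSingularPart (T i) (c i)) :
    M.HasSingularPart (∑ i ∈ t, T i) (fun x => ∑ i ∈ t, c i x) := by
  classical
  induction t using Finset.induction_on with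
  | empty => simpa using zero
  | insert i t hi ih => simpa [Finset.sum_insert hi] using (h i).add ih

theorem act (h : M.HasSingularPart T c) {f : Coord → ℂ}
    (hf : ∀ s, ContDiffOn ℝ 1 f (M.part s)) :
    M.HasSingularPart (act f T) (fun x => f x * c x) := by
  obtain ⟨hc, r, hr, h⟩ := h
  have hfc : ContinuousOn f M.Ω := continuousOn_of_parts fun s => (hf s).continuousOn
  refine ⟨(hfc.mono fun x hx => hx.1).mul hc, fun x => f x * r x,
    hr.continuousOn_mul hfc M.isOpen_Ω.isLocallyClosed, fun χ hχ => ?_⟩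
  rw [Spacetime.act, h _ (hχ.mul_left hf)]
  congr 2 <;> (funext; ring)

/-- The singular part in the normalization by the frame measure `Q δ(v)`. -/
theorem hasDiracPart (h : M.HasSingularPart T c)
    (hc' : ∀ x ∈ M.N0, c x = M.Q .plus x * c' x) : M.HasDiracPart T c' := by
  obtain ⟨hc, r, hr, h⟩ := h
  have hQ : ContinuousOn (fun x => (M.Q .plus x : ℂ)) M.N0 :=
    Complex.continuous_ofReal.comp_continuousOn ((M.regular_Q .plus).continuousOn.mono
      fun x hx => ⟨hx.1, mem_half_of_eq_zero _ hx.2⟩)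
  have hQ0 : ∀ x ∈ M.N0, (M.Q .plus x : ℂ) ≠ 0 := fun x hx =>
    Complex.ofReal_ne_zero.2 (M.Q_pos .plus x ⟨hx.1, mem_half_of_eq_zero _ hx.2⟩).ne'
  refine ⟨(hc.div hQ hQ0).congr fun x hx => ?_, r, hr, fun φ h1 h2 h3 => ?_⟩
  · simp only [Pi.div_apply]
    rw [hc' x hx, mul_div_cancel_left₀ _ (hQ0 x hx)]
  · have hφ := isTest_of_contDiff h1 h2 h3
    rw [h φ hφ]
    congr 2
    funext y
    by_cases hy : onN0 y ∈ M.Ω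
    · rw [hc' _ ⟨hy, rfl⟩]
    · rw [hφ.apply_eq_zero hy]; simp

end HasSingularPart

theorem HasDiracPart.congr {T : Functional} {c c' : Coord → ℂ} (h : M.HasDiracPart T c)
    (hc : ∀ x ∈ M.N0, c' x = c x) : M.HasDiracPart T c' := by
  obtain ⟨hcont, r, hr, h⟩ := h
  refine ⟨hcont.congr hc, r, hr, fun φ h1 h2 h3 => ?_⟩
  rw [h φ h1 h2 h3]
  congr 2
  funext y
  by_cases hy : onN0 y ∈ M.Ω
  · rw [hc _ ⟨hy, rfl⟩]
  · rw [(isTest_of_contDiff h1 h2 h3).apply_eq_zero hy]; simp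

/-! ### Uniqueness of the singular part -/

theorem contDiff_cutoff {η : ℝ → ℝ} (hη : ContDiff ℝ (⊤ : ℕ∞) η) (k : ℝ) :
    ContDiff ℝ (⊤ : ℕ∞) fun x : Coord => (η (k * x 1) : ℂ) := by
  have h1 : ContDiff ℝ (⊤ : ℕ∞) fun x : Coord => k * x 1 :=
    contDiff_const.mul (contDiff_apply ℝ ℝ 1)
  exact Complex.ofRealCLM.contDiff.comp (hη.comp h1)

/-- A locally integrable function does not charge the wall: squeezing a test function onto the
wall makes its contribution vanish, while the wall integral is unchanged. -/
theorem wall_integral_eq_zero {r c : Coord → ℂ} (hr : LocallyIntegrableOn r M.Ω)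
    (h : ∀ φ : Coord → ℂ, ContDiff ℝ (⊤ : ℕ∞) φ → HasCompactSupport φ → tsupport φ ⊆ M.Ω →
      (∫ x, r x * φ x) + ∫ y : Fin 3 → ℝ, c (onN0 y) * φ (onN0 y) = 0)
    {φ : Coord → ℂ} (h1 : ContDiff ℝ (⊤ : ℕ∞) φ) (h2 : HasCompactSupport φ)
    (h3 : tsupport φ ⊆ M.Ω) : ∫ y : Fin 3 → ℝ, c (onN0 y) * φ (onN0 y) = 0 := by
  obtain ⟨η, hηs, -, hη, hη01, hη0⟩ := exists_contDiff_tsupport_subset (E := ℝ)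
    (n := (⊤ : ℕ∞)) (Ioo_mem_nhds (show (-1 : ℝ) < 0 by norm_num) (show (0 : ℝ) < 1 by norm_num))
  have hηle : ∀ t, ‖(η t : ℂ)‖ ≤ 1 := fun t => by
    have := hη01 ⟨t, rfl⟩
    rw [Complex.norm_real, Real.norm_eq_abs, abs_le]
    exact ⟨by linarith [this.1], this.2⟩
  have hηz : ∀ t, 1 ≤ |t| → η t = 0 := fun t ht => by
    by_contra h0
    have := hηs (subset_tsupport η h0)
    exact absurd (abs_lt.2 this) (not_lt.2 ht)
  -- The test function squeezed onto the wall, with unchanged values there.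
  let φk : ℕ → Coord → ℂ := fun k x => (η ((k : ℝ) * x 1) : ℂ) * φ x
  have hwall : ∀ k y, φk k (onN0 y) = φ (onN0 y) := fun k y => by
    simp [φk, onN0_one, hη0]
  have hφ := isTest_of_contDiff h1 h2 h3
  have hint := hφ.integrable_mul hr
  have hlim : Filter.Tendsto (fun k => ∫ x, r x * φk k x) Filter.atTop (𝓝 (∫ _ : Coord, 0)) := by
    refine tendsto_integral_of_dominated_convergence (fun x => ‖r x * φ x‖) (fun k => ?_)
      hint.norm (fun k => Filter.Eventually.of_forall fun x => ?_) ?_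
    · have h4 := (contDiff_cutoff hη k).continuous.aestronglyMeasurable.mul
        hint.aestronglyMeasurable
      refine h4.congr (Filter.Eventually.of_forall fun x => ?_)
      simp only [φk, Pi.mul_apply]
      ring
    · simp only [φk, norm_mul]
      have := mul_le_mul_of_nonneg_right (hηle ((k : ℝ) * x 1)) (norm_nonneg (φ x))
      rw [one_mul] at this
      exact mul_le_mul_of_nonneg_left this (norm_nonneg _)
    · filter_upwards [ae_ne_wall] with x hx
      refine tendsto_const_nhds.congr' ?_
      filter_upwards [Filter.eventually_ge_atTop ⌈1 / |x 1|⌉₊] with k hk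
      have hk' : 1 / |x 1| ≤ (k : ℝ) := Nat.ceil_le.1 hk
      rw [div_le_iff₀ (abs_pos.2 hx)] at hk'
      have : η ((k : ℝ) * x 1) = 0 := hηz _ (by rwa [abs_mul, Nat.abs_cast])
      simp [φk, this]
  have hconst : ∀ k, ∫ x, r x * φk k x = -∫ y : Fin 3 → ℝ, c (onN0 y) * φ (onN0 y) := fun k => by
    have := h (φk k) ((contDiff_cutoff hη k).mul h1) h2.mul_left
      (tsupport_mul_subset_right.trans h3)
    simp only [hwall] at this
    exact eq_neg_of_add_eq_zero_left this
  simp only [hconst, integral_zero] at hlim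
  exact neg_eq_zero.1 (tendsto_nhds_unique tendsto_const_nhds hlim)

/-- A continuous density on the wall whose integrals against smooth functions vanish is zero. -/
theorem eq_zero_of_wall_integral_eq_zero {c : Coord → ℂ} (hc : ContinuousOn c M.N0)
    (h : ∀ φ : Coord → ℂ, ContDiff ℝ (⊤ : ℕ∞) φ → HasCompactSupport φ → tsupport φ ⊆ M.Ω →
      ∫ y : Fin 3 → ℝ, c (onN0 y) * φ (onN0 y) = 0) {x : Coord} (hx : x ∈ M.N0) : c x = 0 := by
  by_contra hcx
  have hev : ∀ᶠ y in 𝓝[M.N0] x, 0 < (c y / c x).re := by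
    have h1 : ContinuousWithinAt (fun y => (c y / c x).re) M.N0 x :=
      Complex.continuous_re.continuousAt.comp_continuousWithinAt ((hc x hx).div_const _)
    refine h1.eventually_mem (Ioi_mem_nhds ?_)
    simp [div_self hcx]
  obtain ⟨U, hU, hUc⟩ := mem_nhdsWithin_iff_exists_mem_nhds_inter.1 hev
  obtain ⟨ψ, hψs, hψc, hψ, hψ01, hψx⟩ := exists_contDiff_tsupport_subset (E := Coord)
    (n := (⊤ : ℕ∞)) (Filter.inter_mem (M.isOpen_Ω.mem_nhds hx.1) hU)
  have hφ : ContDiff ℝ (⊤ : ℕ∞) fun y => (ψ y : ℂ) := Complex.ofRealCLM.contDiff.comp hψ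
  have hφc : HasCompactSupport fun y => (ψ y : ℂ) := hψc.comp_left Complex.ofReal_zero
  have hsub : tsupport (fun y => (ψ y : ℂ)) ⊆ tsupport ψ :=
    closure_mono fun y hy h0 => hy (by simp [h0])
  have hφs : tsupport (fun y => (ψ y : ℂ)) ⊆ M.Ω := hsub.trans (hψs.trans Set.inter_subset_left)
  have hφt := isTest_of_contDiff hφ hφc hφs
  have h0 := h _ hφ hφc hφs
  have hcont := hφt.continuous_wall hc
  have hint := hφt.integrable_wall hc
  let F : (Fin 3 → ℝ) → ℝ := fun y => (c (onN0 y) * (ψ (onN0 y) : ℂ) / c x).re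
  have hF : ∫ y, F y = 0 := by
    have h1 := integral_re (𝕜 := ℂ) (hint.div_const (c x))
    have h2 : ∫ y, c (onN0 y) * (ψ (onN0 y) : ℂ) / c x = 0 := by
      rw [integral_div, h0, zero_div]
    rw [h2] at h1
    simpa using h1
  have hFeq : ∀ y, F y = (c (onN0 y) / c x).re * ψ (onN0 y) := fun y => by
    simp only [F]
    rw [mul_div_right_comm, Complex.re_mul_ofReal]
  have hpos : 0 < ∫ y, F y := by
    refine Continuous.integral_pos_of_hasCompactSupport_nonneg_nonzero
      (x := ![x 0, x 2, x 3]) ?_ ?_ ?_ ?_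
    · exact Complex.continuous_re.comp (hcont.div_const _)
    · refine hφt.hasCompactSupport_onN0.mono fun y hy h' => hy ?_
      have h' : (ψ (onN0 y) : ℂ) = 0 := h'
      simp [F, h']
    · intro y
      rw [hFeq]
      by_cases hy : ψ (onN0 y) = 0
      · simp [hy]
      · have hm := hψs (subset_tsupport ψ hy)
        have hp : 0 < (c (onN0 y) / c x).re := hUc ⟨hm.2, hm.1, rfl⟩
        exact mul_nonneg hp.le (hψ01 ⟨_, rfl⟩).1
    · have hon : onN0 ![x 0, x 2, x 3] = x := by
        funext i
        fin_cases i
        · rfl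
        · exact hx.2.symm
        · rfl
        · rfl
      rw [hFeq, hon, hψx, div_self hcx]
      simp
  exact hpos.ne' hF

/-- Uniqueness of the singular part, in the case of a vanishing Dirac part. -/
theorem HasSingularPart.eq_zero {T : Functional} {c : Coord → ℂ} (h : M.HasSingularPart T c)
    (h0 : M.HasDiracPart T 0) {x : Coord} (hx : x ∈ M.N0) : c x = 0 := by
  obtain ⟨hc, r, hr, h⟩ := h
  obtain ⟨-, r', hr', h'⟩ := h0
  refine eq_zero_of_wall_integral_eq_zero hc (fun φ h1 h2 h3 =>
    wall_integral_eq_zero (hr.sub hr') (fun φ h1 h2 h3 => ?_) h1 h2 h3) hx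
  have hφ := isTest_of_contDiff h1 h2 h3
  have e := (h φ hφ).symm.trans (h' φ h1 h2 h3)
  simp only [Pi.zero_apply, mul_zero, zero_mul, integral_zero, add_zero] at e
  simp only [Pi.sub_apply, sub_mul]
  rw [integral_sub (hφ.integrable_mul hr) (hφ.integrable_mul hr'), ← e]
  ring

/-! ### Regularity of the frame, the metric and the connection -/

section Regularity

variable {S : Set Coord} {k : WithTop ℕ∞}

theorem contDiffOn_conj {f : Coord → ℂ} (hf : ContDiffOn ℝ k f S) :
    ContDiffOn ℝ k (fun x => conj (f x)) S := Complex.conjCLE.contDiff.comp_contDiffOn hf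

theorem contDiffOn_ofReal {f : Coord → ℝ} (hf : ContDiffOn ℝ k f S) :
    ContDiffOn ℝ k (fun x => (f x : ℂ)) S := Complex.ofRealCLM.contDiff.comp_contDiffOn hf

theorem contDiffOn_re {f : Coord → ℂ} (hf : ContDiffOn ℝ k f S) :
    ContDiffOn ℝ k (fun x => (f x).re) S := Complex.reCLM.contDiff.comp_contDiffOn hf

theorem contDiffOn_glue {E : Type*} [NormedAddCommGroup E] [NormedSpace ℝ E]
    {f : Side → Coord → E} (hf : ∀ s, ContDiffOn ℝ k (f s) (M.part s))
    (hm : ∀ x ∈ M.N0, f .plus x = f .minus x) (s : Side) :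
    ContDiffOn ℝ k (glue f) (M.part s) :=
  (hf s).congr fun x hx => glue_eq_of_match s hx.2 fun h0 => hm x ⟨hx.1, h0⟩

variable (M) (s : Side)

theorem contDiffOn_PLow (A : Fin 2) : ContDiffOn ℝ 2 (M.PLow s A) (M.part s) := by
  have h0 := M.regular_P s 0
  have h1 := M.regular_P s 1
  have hden : ContDiffOn ℝ 2 (fun x => (M.P s 0 x * conj (M.P s 1 x)
      - M.P s 1 x * conj (M.P s 0 x))⁻¹) (M.part s) :=
    ((h0.mul (contDiffOn_conj h1)).sub (h1.mul (contDiffOn_conj h0))).inv (M.P_indep s)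
  fin_cases A
  · exact (h1.neg.mul hden).congr fun x _ => by simp [PLow, div_eq_mul_inv]
  · exact (h0.mul hden).congr fun x _ => by simp [PLow, div_eq_mul_inv]

theorem contDiffOn_lUp (a : Fin 4) : ContDiffOn ℝ 2 (M.lUp s a) (M.part s) := by
  fin_cases a
  · exact contDiffOn_const
  · exact contDiffOn_const
  · exact contDiffOn_ofReal (M.regular_C s 0)
  · exact contDiffOn_ofReal (M.regular_C s 1)

theorem contDiffOn_nUp (a : Fin 4) : ContDiffOn ℝ 2 (M.nUp s a) (M.part s) := by
  fin_cases a
  · exact contDiffOn_const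
  · exact contDiffOn_ofReal (M.regular_Q s)
  · exact contDiffOn_const
  · exact contDiffOn_const

theorem contDiffOn_mUp (a : Fin 4) : ContDiffOn ℝ 2 (M.mUp s a) (M.part s) := by
  fin_cases a
  · exact contDiffOn_const
  · exact contDiffOn_const
  · exact M.regular_P s 0
  · exact M.regular_P s 1

theorem contDiffOn_mbUp (a : Fin 4) : ContDiffOn ℝ 2 (M.mbUp s a) (M.part s) :=
  contDiffOn_conj (M.contDiffOn_mUp s a)

theorem contDiffOn_lLow (a : Fin 4) : ContDiffOn ℝ 2 (M.lLow s a) (M.part s) := by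
  fin_cases a
  · exact contDiffOn_const
  · exact (contDiffOn_ofReal (M.regular_Q s)).inv fun x hx =>
      Complex.ofReal_ne_zero.2 (M.Q_pos s x hx).ne'
  · exact contDiffOn_const
  · exact contDiffOn_const

theorem contDiffOn_mLow (a : Fin 4) : ContDiffOn ℝ 2 (M.mLow s a) (M.part s) := by
  fin_cases a
  · change ContDiffOn ℝ 2 (fun x => ∑ B, M.PLow s B x * (M.C s B x : ℂ)) _
    exact ContDiffOn.sum fun B _ =>
      (M.contDiffOn_PLow s B).mul (contDiffOn_ofReal (M.regular_C s B))
  · exact contDiffOn_const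
  · exact (M.contDiffOn_PLow s 0).neg
  · exact (M.contDiffOn_PLow s 1).neg

theorem contDiffOn_nLow (a : Fin 4) : ContDiffOn ℝ 2 (nLow a) (M.part s) := contDiffOn_const

theorem contDiffOn_g (a b : Fin 4) : ContDiffOn ℝ 2 (M.g s a b) (M.part s) :=
  contDiffOn_re (((((M.contDiffOn_lLow s a).mul (M.contDiffOn_nLow s b)).add
    ((M.contDiffOn_nLow s a).mul (M.contDiffOn_lLow s b))).sub
    ((M.contDiffOn_mLow s a).mul (contDiffOn_conj (M.contDiffOn_mLow s b)))).sub
    ((contDiffOn_conj (M.contDiffOn_mLow s a)).mul (M.contDiffOn_mLow s b)))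

theorem contDiffOn_gInv (a b : Fin 4) : ContDiffOn ℝ 2 (M.gInv s a b) (M.part s) :=
  contDiffOn_re (((((M.contDiffOn_lUp s a).mul (M.contDiffOn_nUp s b)).add
    ((M.contDiffOn_nUp s a).mul (M.contDiffOn_lUp s b))).sub
    ((M.contDiffOn_mUp s a).mul (contDiffOn_conj (M.contDiffOn_mUp s b)))).sub
    ((contDiffOn_conj (M.contDiffOn_mUp s a)).mul (M.contDiffOn_mUp s b)))

theorem contDiffOn_pd_g (a b c : Fin 4) :
    ContDiffOn ℝ 1 (pd s (M.g s a b) c) (M.part s) :=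
  contDiffOn_pd M.isOpen_Ω (M.contDiffOn_g s a b) (by norm_num) c

theorem contDiffOn_chr (a b c : Fin 4) : ContDiffOn ℝ 1 (M.chr s a b c) (M.part s) :=
  contDiffOn_const.mul (ContDiffOn.sum fun d _ =>
    ((M.contDiffOn_gInv s a d).of_le (by norm_num)).mul
      (((M.contDiffOn_pd_g s d c b).add (M.contDiffOn_pd_g s d b c)).sub
        (M.contDiffOn_pd_g s b c d)))

end Regularity

/-! ### Continuity of the frame and the metric across the wall -/

section Match

variable {x : Coord}

theorem PLow_match (A : Fin 2) (hx : x ∈ M.N0) : M.PLow .plus A x = M.PLow .minus A x := by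
  simp only [PLow, M.P_match _ x hx.1 hx.2]

theorem lUp_match (a : Fin 4) (hx : x ∈ M.N0) : M.lUp .plus a x = M.lUp .minus a x := by
  simp only [lUp, M.C_eq_zero _ _ x hx.1 hx.2]

theorem mUp_match (a : Fin 4) (hx : x ∈ M.N0) : M.mUp .plus a x = M.mUp .minus a x := by
  simp only [mUp, M.P_match _ x hx.1 hx.2]

theorem mbUp_match (a : Fin 4) (hx : x ∈ M.N0) : M.mbUp .plus a x = M.mbUp .minus a x := by
  simp only [mbUp, mUp_match a hx]

theorem mLow_match (a : Fin 4) (hx : x ∈ M.N0) : M.mLow .plus a x = M.mLow .minus a x := by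
  simp only [mLow, M.C_eq_zero _ _ x hx.1 hx.2, PLow_match _ hx]

theorem nUp_match (hII : M.TypeII) (a : Fin 4) (hx : x ∈ M.N0) :
    M.nUp .plus a x = M.nUp .minus a x := by
  simp only [nUp, hII x hx]

theorem lLow_match (hII : M.TypeII) (a : Fin 4) (hx : x ∈ M.N0) :
    M.lLow .plus a x = M.lLow .minus a x := by
  simp only [lLow, hII x hx]

theorem g_match (hII : M.TypeII) (a b : Fin 4) (hx : x ∈ M.N0) :
    M.g .plus a b x = M.g .minus a b x := by
  simp only [g, lLow_match hII _ hx, mLow_match _ hx]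

theorem gInv_match (hII : M.TypeII) (a b : Fin 4) (hx : x ∈ M.N0) :
    M.gInv .plus a b x = M.gInv .minus a b x := by
  simp only [gInv, lUp_match _ hx, nUp_match hII _ hx, mUp_match _ hx]

theorem contDiffOn_gG (hII : M.TypeII) (a b : Fin 4) (s : Side) :
    ContDiffOn ℝ 1 (M.gG a b) (M.part s) :=
  contDiffOn_ofReal (contDiffOn_glue (fun s => (M.contDiffOn_g s a b).of_le (by norm_num))
    (fun _ hx => g_match hII a b hx) s)

theorem contDiffOn_gInvG (hII : M.TypeII) (a b : Fin 4) (s : Side) :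
    ContDiffOn ℝ 1 (M.gInvG a b) (M.part s) :=
  contDiffOn_ofReal (contDiffOn_glue (fun s => (M.contDiffOn_gInv s a b).of_le (by norm_num))
    (fun _ hx => gInv_match hII a b hx) s)

theorem contDiffOn_l (a : Fin 4) (s : Side) : ContDiffOn ℝ 1 (M.l a) (M.part s) :=
  contDiffOn_glue (fun s => (M.contDiffOn_lUp s a).of_le (by norm_num))
    (fun _ hx => lUp_match a hx) s

theorem contDiffOn_n (hII : M.TypeII) (a : Fin 4) (s : Side) :
    ContDiffOn ℝ 1 (M.n a) (M.part s) :=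
  contDiffOn_glue (fun s => (M.contDiffOn_nUp s a).of_le (by norm_num))
    (fun _ hx => nUp_match hII a hx) s

theorem contDiffOn_m (a : Fin 4) (s : Side) : ContDiffOn ℝ 1 (M.m a) (M.part s) :=
  contDiffOn_glue (fun s => (M.contDiffOn_mUp s a).of_le (by norm_num))
    (fun _ hx => mUp_match a hx) s

theorem contDiffOn_mb (a : Fin 4) (s : Side) : ContDiffOn ℝ 1 (M.mb a) (M.part s) :=
  contDiffOn_glue (fun s => (M.contDiffOn_mbUp s a).of_le (by norm_num))
    (fun _ hx => mbUp_match a hx) s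

end Match

/-! ### The singular part of the curvature in terms of the jump of the connection -/

/-- The jump of the Christoffel symbols. -/
def chrJump (M : Spacetime) (a b c : Fin 4) (x : Coord) : ℂ :=
  jump (fun s y => (M.chr s a b c y : ℂ)) x

/-- The coefficient `k_c [Γ^a_{bd}] - k_d [Γ^a_{bc}]`, with `k = dv`, of the singular part of
`R^a_{bcd}`. -/
def riemSing (M : Spacetime) (a b c d : Fin 4) (x : Coord) : ℂ :=
  (if c = 1 then M.chrJump a b d x else 0) - (if d = 1 then M.chrJump a b c x else 0)

/-- The coefficient of the singular part of `R_{abcd}`. -/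
def riemLowSing (M : Spacetime) (a b c d : Fin 4) (x : Coord) : ℂ :=
  ∑ e, M.gG a e x * M.riemSing e b c d x

/-- The coefficient of the singular part of the Ricci tensor. -/
def ricciSing (M : Spacetime) (b d : Fin 4) (x : Coord) : ℂ := ∑ a, M.riemSing a b a d x

/-- The coefficient of the singular part of the scalar curvature. -/
def scalSing (M : Spacetime) (x : Coord) : ℂ := ∑ b, ∑ d, M.gInvG b d x * M.ricciSing b d x

/-- The coefficient of the singular part of the trace-free Ricci tensor. -/
def tfRicciSing (M : Spacetime) (a b : Fin 4) (x : Coord) : ℂ :=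
  M.ricciSing a b x - 1 / 4 * (M.gG a b x * M.scalSing x)

/-- The coefficient of the singular part of the Weyl tensor. -/
def weylSing (M : Spacetime) (a b c d : Fin 4) (x : Coord) : ℂ :=
  M.riemLowSing a b c d x
    - 1 / 2 * (M.gG a c x * M.ricciSing b d x - M.gG a d x * M.ricciSing b c x
        - M.gG b c x * M.ricciSing a d x + M.gG b d x * M.ricciSing a c x)
    + 1 / 6 * ((M.gG a c x * M.gG b d x - M.gG a d x * M.gG b c x) * M.scalSing x)

theorem glue_ofReal (f : Side → Coord → ℝ) (x : Coord) :
    ((glue f x : ℝ) : ℂ) = glue (fun s y => (f s y : ℂ)) x := by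
  unfold glue
  split_ifs <;> rfl

theorem continuousOn_wall_of_part {c : Side → Coord → ℂ}
    (hc : ∀ s, ContinuousOn (c s) (M.part s)) (s : Side) : ContinuousOn (c s) M.N0 :=
  (hc s).mono fun _ hx => ⟨hx.1, mem_half_of_eq_zero s hx.2⟩

theorem continuousOn_chrJump (a b c : Fin 4) : ContinuousOn (M.chrJump a b c) M.N0 :=
  have h := continuousOn_wall_of_part (c := fun s y => (M.chr s a b c y : ℂ))
    fun s => (contDiffOn_ofReal (M.contDiffOn_chr s a b c)).continuousOn
  (h .plus).sub (h .minus)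

theorem hasSingularPart_riem (a b c d : Fin 4) :
    M.HasSingularPart (M.riem a b c d) (M.riemSing a b c d) := by
  have hchr : ∀ b c s, ContDiffOn ℝ 1 (fun y => (M.chr s a b c y : ℂ)) (M.part s) := fun b c s =>
    contDiffOn_ofReal (M.contDiffOn_chr s a b c)
  have hquad : ∀ s, ContinuousOn (fun x => ((∑ e, (M.chr s a c e x * M.chr s e b d x
      - M.chr s a d e x * M.chr s e b c x) : ℝ) : ℂ)) (M.part s) := fun s =>
    (contDiffOn_ofReal (ContDiffOn.sum fun e _ =>
      ((M.contDiffOn_chr s a c e).mul (M.contDiffOn_chr s e b d)).sub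
        ((M.contDiffOn_chr s a d e).mul (M.contDiffOn_chr s e b c)))).continuousOn
  have hcond : ∀ i b c : Fin 4, ContinuousOn
      (fun x => if i = 1 then M.chrJump a b c x else 0) M.N0 := fun i b c => by
    split_ifs
    · exact continuousOn_chrJump a b c
    · exact continuousOn_const
  have hpd : ∀ b c e, LocallyIntegrableOn
      (glue fun s => pd s (fun y => (M.chr s a b c y : ℂ)) e) M.Ω := fun b c e =>
    locallyIntegrableOn_glue fun s =>
      (contDiffOn_pd (k := 0) M.isOpen_Ω (hchr b c s) (by simp) e).continuousOn
  refine ⟨(hcond c b d).sub (hcond d b c), _,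
    ((hpd b d c).sub (hpd b c d)).add (locallyIntegrableOn_glue hquad), fun χ hχ => ?_⟩
  have h1 := hχ.integral_glue_mul_fderiv (hchr b d) c
  have h2 := hχ.integral_glue_mul_fderiv (hchr b c) d
  have i1 := hχ.integrable_glue_mul_fderiv (fun s => (hchr b d s).continuousOn) c
  have i2 := hχ.integrable_glue_mul_fderiv (fun s => (hchr b c s).continuousOn) d
  have i3 := hχ.integrable_mul (locallyIntegrableOn_glue hquad)
  simp only [riem, glue_ofReal, neg_mul,
    neg_add_eq_sub]
  rw [integral_add (i2.sub' i1) i3, integral_sub i2 i1, sub_eq_add_neg, h1]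
  simp only [Pi.add_apply, Pi.sub_apply, add_mul, sub_mul, riemSing]
  rw [integral_add ((hχ.integrable_mul (hpd b d c)).sub' (hχ.integrable_mul (hpd b c d))) i3,
    integral_sub (hχ.integrable_mul (hpd b d c)) (hχ.integrable_mul (hpd b c d)),
    integral_sub (hχ.integrable_wall (hcond c b d)) (hχ.integrable_wall (hcond d b c))]
  have h2' := neg_eq_iff_eq_neg.1 h2
  rw [h2']
  simp only [chrJump]
  ring

theorem hasSingularPart_riemLow (hII : M.TypeII) (a b c d : Fin 4) :
    M.HasSingularPart (M.riemLow a b c d) (M.riemLowSing a b c d) :=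
  HasSingularPart.sum _ fun e => (hasSingularPart_riem e b c d).act (contDiffOn_gG hII a e)

theorem hasSingularPart_ricci (b d : Fin 4) :
    M.HasSingularPart (M.ricci b d) (M.ricciSing b d) :=
  HasSingularPart.sum _ fun a => hasSingularPart_riem a b a d

theorem hasSingularPart_scal (hII : M.TypeII) : M.HasSingularPart M.scal M.scalSing :=
  HasSingularPart.sum _ fun b => HasSingularPart.sum _ fun d =>
    (hasSingularPart_ricci b d).act (contDiffOn_gInvG hII b d)

theorem hasSingularPart_tfRicci (hII : M.TypeII) (a b : Fin 4) :
    M.HasSingularPart (M.tfRicci a b) (M.tfRicciSing a b) :=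
  (hasSingularPart_ricci a b).sub (((hasSingularPart_scal hII).act (contDiffOn_gG hII a b)).smul _)

theorem hasSingularPart_weyl (hII : M.TypeII) (a b c d : Fin 4) :
    M.HasSingularPart (M.weyl a b c d) (M.weylSing a b c d) := by
  have hr : ∀ a c b d, M.HasSingularPart (Spacetime.act (M.gG a c) (M.ricci b d))
      fun x => M.gG a c x * M.ricciSing b d x := fun a c b d =>
    (hasSingularPart_ricci b d).act (contDiffOn_gG hII a c)
  refine ((hasSingularPart_riemLow hII a b c d).sub
    (((((hr a c b d).sub (hr a d b c)).sub (hr b c a d)).add (hr b d a c)).smul _)).add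
    (((hasSingularPart_scal hII).act fun s => ?_).smul _)
  exact ((contDiffOn_gG hII a c s).mul (contDiffOn_gG hII b d s)).sub
    ((contDiffOn_gG hII a d s).mul (contDiffOn_gG hII b c s))

theorem hasSingularPart_weylC (hII : M.TypeII) {X Y Z W : Fin 4 → Coord → ℂ}
    (hX : ∀ a s, ContDiffOn ℝ 1 (X a) (M.part s)) (hY : ∀ a s, ContDiffOn ℝ 1 (Y a) (M.part s))
    (hZ : ∀ a s, ContDiffOn ℝ 1 (Z a) (M.part s)) (hW : ∀ a s, ContDiffOn ℝ 1 (W a) (M.part s)) :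
    M.HasSingularPart (M.weylC X Y Z W) (fun x => ∑ a, ∑ b, ∑ c, ∑ d,
      X a x * Y b x * Z c x * W d x * M.weylSing a b c d x) :=
  HasSingularPart.sum _ fun a => HasSingularPart.sum _ fun b => HasSingularPart.sum _ fun c =>
    HasSingularPart.sum _ fun d => (hasSingularPart_weyl hII a b c d).act fun s =>
      (((hX a s).mul (hY b s)).mul (hZ c s)).mul (hW d s)

theorem hasSingularPart_tfRicciC (hII : M.TypeII) {X Y : Fin 4 → Coord → ℂ}
    (hX : ∀ a s, ContDiffOn ℝ 1 (X a) (M.part s)) (hY : ∀ a s, ContDiffOn ℝ 1 (Y a) (M.part s)) :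
    M.HasSingularPart (M.tfRicciC X Y) (fun x => ∑ a, ∑ b,
      X a x * Y b x * M.tfRicciSing a b x) :=
  HasSingularPart.sum _ fun a => HasSingularPart.sum _ fun b =>
    (hasSingularPart_tfRicci hII a b).act fun s => (hX a s).mul (hY b s)

/-! ### The metric and its first derivatives at the wall -/

theorem g_ofReal (s : Side) (a b : Fin 4) (x : Coord) :
    (M.g s a b x : ℂ) = M.lLow s a x * nLow b x + nLow a x * M.lLow s b x
      - M.mLow s a x * conj (M.mLow s b x) - conj (M.mLow s a x) * M.mLow s b x := by
  have hl : ∀ a, conj (M.lLow s a x) = M.lLow s a x := fun a => by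
    fin_cases a <;> simp [lLow]
  have hn : ∀ a, conj (nLow a x) = nLow a x := fun a => by
    fin_cases a <;> simp [nLow]
  rw [g, Complex.re_eq_add_conj]
  simp only [map_sub, map_add, map_mul, hl, hn, Complex.conj_conj]
  ring

theorem gInv_ofReal (s : Side) (a b : Fin 4) (x : Coord) :
    (M.gInv s a b x : ℂ) = M.lUp s a x * M.nUp s b x + M.nUp s a x * M.lUp s b x
      - M.mUp s a x * conj (M.mUp s b x) - conj (M.mUp s a x) * M.mUp s b x := by
  have hl : ∀ a, conj (M.lUp s a x) = M.lUp s a x := fun a => by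
    fin_cases a <;> simp [lUp]
  have hn : ∀ a, conj (M.nUp s a x) = M.nUp s a x := fun a => by
    fin_cases a <;> simp [nUp]
  rw [gInv, Complex.re_eq_add_conj]
  simp only [map_sub, map_add, map_mul, hl, hn, Complex.conj_conj]
  ring

theorem g_symm (s : Side) (a b : Fin 4) : M.g s a b = M.g s b a := by
  funext x
  rw [← Complex.ofReal_inj, g_ofReal, g_ofReal]
  ring

theorem g_zero_zero (s : Side) :
    M.g s 0 0 = fun x => -2 * ((M.mLow s 0 x).re * (M.mLow s 0 x).re
      + (M.mLow s 0 x).im * (M.mLow s 0 x).im) := by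
  funext x
  simp [g, lLow, nLow]
  ring

theorem mLow_zero_eq_zero (s : Side) {x : Coord} (hx : x ∈ M.N0) : M.mLow s 0 x = 0 := by
  simp [mLow, M.C_eq_zero s _ x hx.1 hx.2]

/-- The component `g₀₀` is quadratic in `C^A`, so it vanishes on the wall to second order. -/
theorem pd_g_zero_zero (s : Side) (c : Fin 4) {x : Coord} (hx : x ∈ M.N0) :
    pd s (M.g s 0 0) c x = 0 := by
  have hxs : x ∈ half s := mem_half_of_eq_zero s hx.2
  have hu := uniqueDiffOn_half s x hxs
  have hd := differentiableWithinAt_half M.isOpen_Ω (M.contDiffOn_mLow s 0) two_ne_zero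
    ⟨hx.1, hxs⟩
  have hre : DifferentiableWithinAt ℝ (fun y => (M.mLow s 0 y).re) (half s) x :=
    Complex.reCLM.differentiableAt.comp_differentiableWithinAt x hd
  have him : DifferentiableWithinAt ℝ (fun y => (M.mLow s 0 y).im) (half s) x :=
    Complex.imCLM.differentiableAt.comp_differentiableWithinAt x hd
  have h0 := mLow_zero_eq_zero s hx
  rw [g_zero_zero, pd, fderivWithin_const_mul hu ((hre.fun_mul hre).fun_add (him.fun_mul him)),
    fderivWithin_fun_add hu (hre.fun_mul hre) (him.fun_mul him), fderivWithin_fun_mul hu hre hre,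
    fderivWithin_fun_mul hu him him]
  simp [h0]

/-- The jump `γ_{ab} = [∂_v g_{ab}]` of the transversal derivative of the metric. -/
def gJump (M : Spacetime) (a b : Fin 4) (x : Coord) : ℝ :=
  jump (fun s => pd s (M.g s a b) 1) x

theorem gJump_symm (a b : Fin 4) (x : Coord) : M.gJump a b x = M.gJump b a x := by
  simp only [gJump, jump, g_symm _ a b]

theorem pd_zero_fun (s : Side) (c : Fin 4) (x : Coord) : pd s (fun _ => (0 : ℝ)) c x = 0 := by
  simp [pd]

theorem gJump_zero_zero {x : Coord} (hx : x ∈ M.N0) : M.gJump 0 0 x = 0 := by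
  simp [gJump, jump, pd_g_zero_zero _ 1 hx]

/-- For a continuous metric, only the transversal derivative can jump. -/
theorem pd_g_plus (hII : M.TypeII) (a b c : Fin 4) {x : Coord} (hx : x ∈ M.N0) :
    pd .plus (M.g .plus a b) c x =
      pd .minus (M.g .minus a b) c x + if c = 1 then M.gJump a b x else 0 := by
  split_ifs with h
  · subst h
    simp [gJump, jump]
  · rw [add_zero]
    exact pd_tangential_eq (f := fun s => M.g s a b) M.isOpen_Ω
      (fun s => (M.contDiffOn_g s a b).of_le (by norm_num))
      (fun x h1 h2 => g_match hII a b ⟨h1, h2⟩) h hx.1 hx.2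

/-- The covector `dv`, conormal to the wall. -/
def conormal (a : Fin 4) : ℂ := if a = 1 then 1 else 0

theorem chrJump_eq (hII : M.TypeII) (a b c : Fin 4) {x : Coord} (hx : x ∈ M.N0) :
    M.chrJump a b c x = 1 / 2 * ∑ d, (M.gInv .plus a d x : ℂ) *
      (conormal b * M.gJump d c x + conormal c * M.gJump d b x - conormal d * M.gJump b c x) := by
  simp only [chrJump, jump, chr, pd_g_plus hII _ _ _ hx, gInv_match hII _ _ hx]
  push_cast
  rw [← mul_sub, ← Finset.sum_sub_distrib]
  congr 1
  refine Finset.sum_congr rfl fun d _ => ?_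
  have h : ∀ (i : Fin 4) (t : ℝ), (((if i = 1 then t else 0 : ℝ)) : ℂ) = conormal i * t :=
    fun i t => by unfold conormal; split_ifs <;> simp
  simp only [h]
  ring

theorem gG_wall (a b : Fin 4) {x : Coord} (hx : x ∈ M.N0) : M.gG a b x = M.g .plus a b x := by
  rw [gG, glue_of_nonneg hx.2.ge]

theorem gInvG_wall (a b : Fin 4) {x : Coord} (hx : x ∈ M.N0) :
    M.gInvG a b x = M.gInv .plus a b x := by
  rw [gInvG, glue_of_nonneg hx.2.ge]

theorem mem_part_of_mem_N0 {x : Coord} (hx : x ∈ M.N0) (s : Side) : x ∈ M.part s :=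
  ⟨hx.1, mem_half_of_eq_zero s hx.2⟩

theorem Q_ne_zero {x : Coord} (hx : x ∈ M.N0) : (M.Q .plus x : ℂ) ≠ 0 :=
  Complex.ofReal_ne_zero.2 (M.Q_pos .plus x (mem_part_of_mem_N0 hx _)).ne'

/-- `gInv` is the inverse of `g`; on the wall this only involves `C^A = 0`. -/
theorem sum_g_mul_gInv (a d : Fin 4) {x : Coord} (hx : x ∈ M.N0) :
    ∑ e, (M.g .plus a e x : ℂ) * (M.gInv .plus e d x : ℂ) = if a = d then 1 else 0 := by
  have hC := fun A => M.C_eq_zero .plus A x hx.1 hx.2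
  have hQ := Q_ne_zero hx
  have hP := M.P_indep .plus x (mem_part_of_mem_N0 hx _)
  have hP' : conj (M.P .plus 0 x) * M.P .plus 1 x - conj (M.P .plus 1 x) * M.P .plus 0 x ≠ 0 :=
    fun h => hP (by linear_combination -h)
  have hP'' : M.P .plus 1 x * conj (M.P .plus 0 x) - M.P .plus 0 x * conj (M.P .plus 1 x) ≠ 0 :=
    fun h => hP (by linear_combination -h)
  simp only [g_ofReal, gInv_ofReal, Fin.sum_univ_four]
  fin_cases a <;> fin_cases d <;>
    simp [lLow, nLow, mLow, lUp, nUp, mUp, PLow, hC, hQ] <;> field_simp <;> ring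

theorem gInv_one (d : Fin 4) {x : Coord} (hx : x ∈ M.N0) :
    (M.gInv .plus 1 d x : ℂ) = if d = 0 then (M.Q .plus x : ℂ) else 0 := by
  have hC := fun A => M.C_eq_zero .plus A x hx.1 hx.2
  rw [gInv_ofReal]
  fin_cases d <;> simp [lUp, nUp, mUp, hC]

theorem gInv_zero (d : Fin 4) (x : Coord) :
    (M.gInv .plus 0 d x : ℂ) = if d = 1 then (M.Q .plus x : ℂ) else 0 := by
  rw [gInv_ofReal]
  fin_cases d <;> simp [lUp, nUp, mUp]

theorem gInv_symm (a b : Fin 4) (x : Coord) : M.gInv .plus a b x = M.gInv .plus b a x := by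
  rw [← Complex.ofReal_inj, gInv_ofReal, gInv_ofReal]
  ring

/-! ### The singular part of the curvature at the wall -/

/-- The contraction of the metric jump with `m` and `conj m`. -/
def gJumpM (M : Spacetime) (x : Coord) : ℂ :=
  M.gJump 2 2 x * (M.P .plus 0 x * conj (M.P .plus 0 x))
    + M.gJump 2 3 x * (M.P .plus 0 x * conj (M.P .plus 1 x) + M.P .plus 1 x * conj (M.P .plus 0 x))
    + M.gJump 3 3 x * (M.P .plus 1 x * conj (M.P .plus 1 x))

/-- The contraction of the metric jump with `conj m` and `conj m`. -/
def gJumpMbMb (M : Spacetime) (x : Coord) : ℂ :=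
  M.gJump 2 2 x * conj (M.P .plus 0 x) ^ 2
    + 2 * (M.gJump 2 3 x * (conj (M.P .plus 0 x) * conj (M.P .plus 1 x)))
    + M.gJump 3 3 x * conj (M.P .plus 1 x) ^ 2

/-- The contraction of the metric jump with `l` and `conj m`. -/
def gJumpLMb (M : Spacetime) (x : Coord) : ℂ :=
  M.gJump 0 2 x * conj (M.P .plus 0 x) + M.gJump 0 3 x * conj (M.P .plus 1 x)

theorem riemLowSing_eq (hII : M.TypeII) (a b c d : Fin 4) {x : Coord} (hx : x ∈ M.N0) :
    M.riemLowSing a b c d x = 1 / 2 * (conormal b * conormal c * M.gJump a d x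
      - conormal a * conormal c * M.gJump b d x - conormal b * conormal d * M.gJump a c x
      + conormal a * conormal d * M.gJump b c x) := by
  have hif : ∀ (i : Fin 4) (t : ℂ), (if i = 1 then t else 0) = conormal i * t :=
    fun i t => by unfold conormal; split_ifs <;> simp
  have hlow : ∀ b c, ∑ e, (M.g .plus a e x : ℂ) * M.chrJump e b c x =
      1 / 2 * (conormal b * M.gJump a c x + conormal c * M.gJump a b x
        - conormal a * M.gJump b c x) := fun b c => by
    simp only [chrJump_eq hII _ _ _ hx, Finset.mul_sum]
    rw [Finset.sum_comm]
    have h : ∀ f, (∑ e, (M.g .plus a e x : ℂ) * (1 / 2 * ((M.gInv .plus e f x : ℂ) *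
        (conormal b * M.gJump f c x + conormal c * M.gJump f b x
          - conormal f * M.gJump b c x)))) =
        (if a = f then 1 else 0) * (1 / 2 * (conormal b * M.gJump f c x
          + conormal c * M.gJump f b x - conormal f * M.gJump b c x)) := fun f => by
      rw [← sum_g_mul_gInv a f hx, Finset.sum_mul]
      exact Finset.sum_congr rfl fun e _ => by ring
    simp only [h, ite_mul, one_mul, zero_mul, Finset.sum_ite_eq, Finset.mem_univ, if_true]
  have hsplit : M.riemLowSing a b c d x =
      conormal c * (∑ e, (M.g .plus a e x : ℂ) * M.chrJump e b d x)
        - conormal d * ∑ e, (M.g .plus a e x : ℂ) * M.chrJump e b c x := by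
    simp only [riemLowSing, riemSing, gG_wall _ _ hx, hif, Finset.mul_sum]
    rw [← Finset.sum_sub_distrib]
    exact Finset.sum_congr rfl fun e _ => by ring
  rw [hsplit, hlow, hlow]
  ring

theorem chrJump_one (hII : M.TypeII) (b c : Fin 4) {x : Coord} (hx : x ∈ M.N0) :
    M.chrJump 1 b c x = M.Q .plus x / 2 *
      (conormal b * M.gJump 0 c x + conormal c * M.gJump 0 b x) := by
  rw [chrJump_eq hII _ _ _ hx]
  simp only [gInv_one _ hx, ite_mul, zero_mul, Finset.sum_ite_eq', Finset.mem_univ, if_true]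
  simp [conormal]
  ring

theorem chrJump_zero (hII : M.TypeII) (b c : Fin 4) {x : Coord} (hx : x ∈ M.N0) :
    M.chrJump 0 b c x = M.Q .plus x / 2 *
      (conormal b * M.gJump 1 c x + conormal c * M.gJump 1 b x - M.gJump b c x) := by
  rw [chrJump_eq hII _ _ _ hx]
  simp only [gInv_zero, ite_mul, zero_mul, Finset.sum_ite_eq', Finset.mem_univ, if_true]
  simp [conormal]
  ring

theorem sum_chrJump (hII : M.TypeII) (b : Fin 4) {x : Coord} (hx : x ∈ M.N0) :
    ∑ a, M.chrJump a b a x =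
      conormal b * (M.Q .plus x * M.gJump 0 1 x - M.gJumpM x) := by
  have hC := fun A => M.C_eq_zero .plus A x hx.1 hx.2
  -- These two terms of the contracted Christoffel symbol cancel by symmetry.
  have hswap : ∑ a, ∑ d, (M.gInv .plus a d x : ℂ) * (conormal a * M.gJump d b x) =
      ∑ a, ∑ d, (M.gInv .plus a d x : ℂ) * (conormal d * M.gJump b a x) := by
    rw [Finset.sum_comm]
    simp only [gInv_symm _ _ x, gJump_symm b]
  have htr : ∑ a, ∑ d, (M.gInv .plus a d x : ℂ) * M.gJump d a x =
      2 * (M.Q .plus x * M.gJump 0 1 x - M.gJumpM x) := by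
    simp only [Fin.sum_univ_four, gInv_ofReal]
    simp [lUp, nUp, mUp, hC, gJumpM, gJump_symm 1 0, gJump_symm 3 2]
    ring
  have h : ∑ a, M.chrJump a b a x = 1 / 2 *
      (conormal b * (∑ a, ∑ d, (M.gInv .plus a d x : ℂ) * M.gJump d a x)
        + (∑ a, ∑ d, (M.gInv .plus a d x : ℂ) * (conormal a * M.gJump d b x)
        - ∑ a, ∑ d, (M.gInv .plus a d x : ℂ) * (conormal d * M.gJump b a x))) := by
    simp only [chrJump_eq hII _ _ _ hx, Finset.mul_sum, ← Finset.sum_sub_distrib,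
      ← Finset.sum_add_distrib]
    exact Finset.sum_congr rfl fun a _ => Finset.sum_congr rfl fun d _ => by ring
  rw [h, hswap, htr]
  ring

theorem ricciSing_eq (hII : M.TypeII) (b d : Fin 4) {x : Coord} (hx : x ∈ M.N0) :
    M.ricciSing b d x = M.Q .plus x / 2 *
        (conormal b * M.gJump 0 d x + conormal d * M.gJump 0 b x)
      - conormal b * conormal d * (M.Q .plus x * M.gJump 0 1 x - M.gJumpM x) := by
  have h : M.ricciSing b d x = M.chrJump 1 b d x - conormal d * ∑ a, M.chrJump a b a x := by
    simp only [ricciSing, riemSing, Finset.sum_sub_distrib, Finset.sum_ite_eq', Finset.mem_univ,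
      if_true, conormal]
    congr 1
    split_ifs <;> simp
  rw [h, chrJump_one hII _ _ hx, sum_chrJump hII _ hx]
  ring

theorem scalSing_eq (hII : M.TypeII) {x : Coord} (hx : x ∈ M.N0) : M.scalSing x = 0 := by
  have hC := fun A => M.C_eq_zero .plus A x hx.1 hx.2
  simp only [scalSing, ricciSing_eq hII _ _ hx, gInvG_wall _ _ hx, Fin.sum_univ_four,
    gInv_ofReal]
  simp [lUp, nUp, mUp, hC, conormal, gJump_zero_zero hx]

theorem tfRicciSing_eq (hII : M.TypeII) (a b : Fin 4) {x : Coord} (hx : x ∈ M.N0) :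
    M.tfRicciSing a b x = M.ricciSing a b x := by
  simp [tfRicciSing, scalSing_eq hII hx]

theorem weylSing_eq (hII : M.TypeII) (a b c d : Fin 4) {x : Coord} (hx : x ∈ M.N0) :
    M.weylSing a b c d x = M.riemLowSing a b c d x
      - 1 / 2 * (M.gG a c x * M.ricciSing b d x - M.gG a d x * M.ricciSing b c x
        - M.gG b c x * M.ricciSing a d x + M.gG b d x * M.ricciSing a c x) := by
  simp [weylSing, scalSing_eq hII hx]

theorem l_wall (a : Fin 4) {x : Coord} (hx : x ∈ M.N0) :
    M.l a x = (![1, 0, 0, 0] : Fin 4 → ℂ) a := by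
  simp [l, glue_of_nonneg hx.2.ge, lUp, M.C_eq_zero _ _ x hx.1 hx.2]

theorem n_wall (a : Fin 4) {x : Coord} (hx : x ∈ M.N0) :
    M.n a x = (![0, (M.Q .plus x : ℂ), 0, 0] : Fin 4 → ℂ) a := by
  simp [n, glue_of_nonneg hx.2.ge, nUp]

theorem m_wall (a : Fin 4) {x : Coord} (hx : x ∈ M.N0) :
    M.m a x = (![0, 0, M.P .plus 0 x, M.P .plus 1 x] : Fin 4 → ℂ) a := by
  simp [m, glue_of_nonneg hx.2.ge, mUp]

theorem mb_wall (a : Fin 4) {x : Coord} (hx : x ∈ M.N0) :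
    M.mb a x = (![0, 0, conj (M.P .plus 0 x), conj (M.P .plus 1 x)] : Fin 4 → ℂ) a := by
  rw [mb, glue_of_nonneg hx.2.ge]
  fin_cases a <;> simp [mbUp, mUp]

theorem gG_zero_wall (b : Fin 4) {x : Coord} (hx : x ∈ M.N0) :
    M.gG 0 b x = if b = 1 then (M.Q .plus x : ℂ)⁻¹ else 0 := by
  have hC := fun A => M.C_eq_zero .plus A x hx.1 hx.2
  rw [gG_wall _ _ hx, g_ofReal]
  fin_cases b <;> simp [lLow, nLow, mLow, hC]

theorem gG_one_wall (b : Fin 4) {x : Coord} (hx : x ∈ M.N0) :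
    M.gG 1 b x = if b = 0 then (M.Q .plus x : ℂ)⁻¹ else 0 := by
  rw [gG_wall _ _ hx, g_ofReal]
  fin_cases b <;> simp [lLow, nLow, mLow]

theorem gG_symm (a b : Fin 4) (x : Coord) : M.gG a b x = M.gG b a x := by
  simp only [gG, g_symm _ a b]

/-! ### The jumps of the connection scalars -/

/-- For a continuous covector field, the jump of a tangential covariant derivative comes from the
connection alone. -/
theorem jump_cov {ω : Side → Fin 4 → Coord → ℂ}
    (hω : ∀ s a, ContDiffOn ℝ 2 (ω s a) (M.part s))
    (hm : ∀ a, ∀ x ∈ M.N0, ω .plus a x = ω .minus a x) (a : Fin 4) {b : Fin 4} (hb : b ≠ 1)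
    {x : Coord} (hx : x ∈ M.N0) :
    M.cov .plus (ω .plus) a b x - M.cov .minus (ω .minus) a b x =
      -∑ c, M.chrJump c b a x * ω .plus c x := by
  have h := pd_tangential_eq (f := fun s => ω s a) M.isOpen_Ω
    (fun s => (hω s a).of_le (by norm_num)) (fun x h1 h2 => hm a x ⟨h1, h2⟩) hb hx.1 hx.2
  simp only [cov, chrJump, jump, sub_mul, Finset.sum_sub_distrib, h, hm _ x hx]
  ring

theorem jump_lam (hII : M.TypeII) {x : Coord} (hx : x ∈ M.N0) :
    jump M.lam x = -(M.Q .plus x / 2 * M.gJumpMbMb x) := by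
  have h := fun (b : Fin 4) (hb : b ≠ 1) (a : Fin 4) => jump_cov (ω := fun _ => nLow)
    (fun s a => M.contDiffOn_nLow s a) (fun _ _ _ => rfl) a hb hx
  have h2 := h 2 (by decide)
  have h3 := h 3 (by decide)
  have e : jump M.lam x = -∑ a, ∑ b, M.mbUp .plus a x * M.mbUp .plus b x *
      (M.cov .plus nLow a b x - M.cov .minus nLow a b x) := by
    simp only [jump, lam, mbUp_match _ hx, mul_sub, Finset.sum_sub_distrib]
    ring
  rw [e]
  simp [Fin.sum_univ_four, mbUp, mUp, h2, h3, nLow, chrJump_zero hII _ _ hx, conormal, gJumpMbMb,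
    gJump_symm 3 2]
  ring

theorem jump_mu (hII : M.TypeII) {x : Coord} (hx : x ∈ M.N0) :
    jump M.mu x = -(M.Q .plus x / 2 * M.gJumpM x) := by
  have h := fun (b : Fin 4) (hb : b ≠ 1) (a : Fin 4) => jump_cov (ω := fun _ => nLow)
    (fun s a => M.contDiffOn_nLow s a) (fun _ _ _ => rfl) a hb hx
  have h2 := h 2 (by decide)
  have h3 := h 3 (by decide)
  have e : jump M.mu x = -∑ a, ∑ b, M.mbUp .plus a x * M.mUp .plus b x *
      (M.cov .plus nLow a b x - M.cov .minus nLow a b x) := by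
    simp only [jump, mu, mbUp_match _ hx, mUp_match _ hx, mul_sub, Finset.sum_sub_distrib]
    ring
  rw [e]
  simp [Fin.sum_univ_four, mbUp, mUp, h2, h3, nLow, chrJump_zero hII _ _ hx, conormal, gJumpM,
    gJump_symm 3 2]
  ring

theorem chrJump_tangential (hII : M.TypeII) {a b c : Fin 4} (ha : a ≠ 0) (hb : b ≠ 1)
    (hc : c ≠ 1) {x : Coord} (hx : x ∈ M.N0) : M.chrJump a b c x = 0 := by
  rw [chrJump_eq hII _ _ _ hx, Fin.sum_univ_four]
  have h := gInv_one a hx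
  rw [gInv_symm, if_neg ha] at h
  simp [conormal, hb, hc, h]

theorem jump_alpha (hII : M.TypeII) {x : Coord} (hx : x ∈ M.N0) :
    jump M.alpha x = -(M.Q .plus x / 4 * M.gJumpLMb x) := by
  have hl := fun (b : Fin 4) (hb : b ≠ 1) (a : Fin 4) => jump_cov (ω := M.lLow)
    M.contDiffOn_lLow (fun a _ hx => lLow_match hII a hx) a hb hx
  have hm := fun (b : Fin 4) (hb : b ≠ 1) (a : Fin 4) => jump_cov (ω := M.mLow)
    M.contDiffOn_mLow (fun a _ hx => mLow_match a hx) a hb hx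
  have hl2 := hl 2 (by decide)
  have hl3 := hl 3 (by decide)
  have hm2 := hm 2 (by decide)
  have hm3 := hm 3 (by decide)
  have hQ := Q_ne_zero hx
  have e : jump M.alpha x = 1 / 2 * ∑ a, ∑ b, (M.nUp .plus a x * M.mbUp .plus b x *
      (M.cov .plus (M.lLow .plus) a b x - M.cov .minus (M.lLow .minus) a b x)
      - M.mbUp .plus a x * M.mbUp .plus b x *
      (M.cov .plus (M.mLow .plus) a b x - M.cov .minus (M.mLow .minus) a b x)) := by
    simp only [jump, alpha, mbUp_match _ hx, nUp_match hII _ hx, mul_sub, Finset.sum_sub_distrib]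
    ring
  have hC0 := mLow_zero_eq_zero .plus hx
  have ht := fun (a b c : Fin 4) ha hb hc =>
    chrJump_tangential hII (a := a) (b := b) (c := c) ha hb hc hx
  rw [e]
  simp only [Fin.sum_univ_four, hl2, hl3, hm2, hm3, hC0,
    ht 2 2 2 (by decide) (by decide) (by decide), ht 2 2 3 (by decide) (by decide) (by decide),
    ht 2 3 2 (by decide) (by decide) (by decide), ht 2 3 3 (by decide) (by decide) (by decide),
    ht 3 2 2 (by decide) (by decide) (by decide), ht 3 2 3 (by decide) (by decide) (by decide),
    ht 3 3 2 (by decide) (by decide) (by decide), ht 3 3 3 (by decide) (by decide) (by decide)]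
  simp [mbUp, mUp, nUp, lLow, mLow, chrJump_one hII _ _ hx, conormal, gJumpLMb]
  field_simp
  ring

/-- Since `m` and `conj m` are independent, the real covector `γ_{0A}` vanishes if its
contraction with `conj m` does. -/
theorem gJumpLMb_eq_zero_iff {x : Coord} (hx : x ∈ M.N0) :
    M.gJumpLMb x = 0 ↔ M.gJump 0 2 x = 0 ∧ M.gJump 0 3 x = 0 := by
  refine ⟨fun h => ?_, fun h => by simp [gJumpLMb, h.1, h.2]⟩
  have hP := M.P_indep .plus x (mem_part_of_mem_N0 hx _)
  have h' := congrArg conj h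
  simp only [gJumpLMb, map_add, map_mul, Complex.conj_ofReal, Complex.conj_conj, map_zero] at h h'
  constructor
  · refine Complex.ofReal_eq_zero.1 ((mul_eq_zero.1 ?_).resolve_right hP)
    linear_combination conj (M.P .plus 1 x) * h' - M.P .plus 1 x * h
  · refine Complex.ofReal_eq_zero.1 ((mul_eq_zero.1 ?_).resolve_right hP)
    linear_combination M.P .plus 0 x * h - conj (M.P .plus 0 x) * h'

theorem jump_alpha_eq_zero_iff (hII : M.TypeII) {x : Coord} (hx : x ∈ M.N0) :
    jump M.alpha x = 0 ↔ M.gJump 0 2 x = 0 ∧ M.gJump 0 3 x = 0 := by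
  rw [jump_alpha hII hx, ← gJumpLMb_eq_zero_iff hx]
  simp [Q_ne_zero hx]

theorem jump_conj_alpha (x : Coord) :
    jump (fun s y => conj (M.alpha s y)) x = conj (jump M.alpha x) := by
  simp [jump]

/-! ### The Dirac parts of the Newman–Penrose scalars -/

/-- The vector `conj m` is null. -/
theorem gG_mb_mb {x : Coord} (hx : x ∈ M.N0) :
    M.gG 2 2 x * conj (M.P .plus 0 x) ^ 2
      + 2 * (M.gG 2 3 x * (conj (M.P .plus 0 x) * conj (M.P .plus 1 x)))
      + M.gG 3 3 x * conj (M.P .plus 1 x) ^ 2 = 0 := by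
  have h := congrArg conj (M.PLow_contract .plus x (mem_part_of_mem_N0 hx _)).1
  simp only [Fin.sum_univ_two, map_add, map_mul, map_zero] at h
  simp only [gG_wall _ _ hx, g_ofReal]
  simp [nLow, mLow]
  linear_combination -2 * (M.PLow .plus 0 x * conj (M.P .plus 0 x)
    + M.PLow .plus 1 x * conj (M.P .plus 1 x)) * h

theorem hasDiracPart_Psi0 (hII : M.TypeII) : M.HasDiracPart M.Psi0 0 := by
  refine (hasSingularPart_weylC hII contDiffOn_l contDiffOn_m contDiffOn_l
    contDiffOn_m).neg.hasDiracPart fun x hx => ?_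
  simp [Fin.sum_univ_four, l_wall _ hx, m_wall _ hx,
    weylSing_eq hII _ _ _ _ hx, riemLowSing_eq hII _ _ _ _ hx, ricciSing_eq hII _ _ hx, conormal,
    gG_zero_wall _ hx]

theorem hasDiracPart_Psi1 (hII : M.TypeII) : M.HasDiracPart M.Psi1 0 := by
  refine (hasSingularPart_weylC hII contDiffOn_l contDiffOn_m contDiffOn_l
    (contDiffOn_n hII)).neg.hasDiracPart fun x hx => ?_
  simp [Fin.sum_univ_four, l_wall _ hx, m_wall _ hx, n_wall _ hx,
    weylSing_eq hII _ _ _ _ hx, riemLowSing_eq hII _ _ _ _ hx, ricciSing_eq hII _ _ hx, conormal,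
    gG_zero_wall _ hx, gJump_zero_zero hx]

theorem hasDiracPart_Psi2 (hII : M.TypeII) : M.HasDiracPart M.Psi2 0 := by
  refine (hasSingularPart_weylC hII contDiffOn_l contDiffOn_m contDiffOn_mb
    (contDiffOn_n hII)).neg.hasDiracPart fun x hx => ?_
  simp [Fin.sum_univ_four, l_wall _ hx, m_wall _ hx, mb_wall _ hx, n_wall _ hx,
    weylSing_eq hII _ _ _ _ hx, riemLowSing_eq hII _ _ _ _ hx, ricciSing_eq hII _ _ hx, conormal,
    gG_zero_wall _ hx, gJump_zero_zero hx]

theorem hasDiracPart_Psi3 (hII : M.TypeII) : M.HasDiracPart M.Psi3 (fun x => -jump M.alpha x) := by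
  refine (hasSingularPart_weylC hII contDiffOn_l (contDiffOn_n hII) contDiffOn_mb
    (contDiffOn_n hII)).neg.hasDiracPart fun x hx => ?_
  have hQ := Q_ne_zero hx
  simp [Fin.sum_univ_four, l_wall _ hx, n_wall _ hx, mb_wall _ hx,
    weylSing_eq hII _ _ _ _ hx, riemLowSing_eq hII _ _ _ _ hx, ricciSing_eq hII _ _ hx, conormal,
    gG_zero_wall _ hx, gG_one_wall _ hx, jump_alpha hII hx, gJumpLMb]
  field_simp
  ring

theorem hasDiracPart_Psi4 (hII : M.TypeII) : M.HasDiracPart M.Psi4 (fun x => -jump M.lam x) := by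
  refine (hasSingularPart_weylC hII contDiffOn_mb (contDiffOn_n hII) contDiffOn_mb
    (contDiffOn_n hII)).neg.hasDiracPart fun x hx => ?_
  have hmb := gG_mb_mb hx
  simp [Fin.sum_univ_four, n_wall _ hx, mb_wall _ hx,
    weylSing_eq hII _ _ _ _ hx, riemLowSing_eq hII _ _ _ _ hx, ricciSing_eq hII _ _ hx, conormal,
    gG_zero_wall _ hx, gG_one_wall _ hx, jump_lam hII hx, gJumpMbMb, gG_symm 3 2, gG_symm 3 1,
    gG_symm 2 1, gJump_symm 3 2]
  linear_combination (M.Q .plus x : ℂ) ^ 2 * M.gJumpM x / 2 * hmb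

theorem hasDiracPart_Phi00 (hII : M.TypeII) : M.HasDiracPart M.Phi00 0 := by
  refine ((hasSingularPart_tfRicciC hII contDiffOn_l contDiffOn_l).smul
    _).hasDiracPart fun x hx => ?_
  simp [Fin.sum_univ_four, l_wall _ hx, tfRicciSing_eq hII _ _ hx,
    ricciSing_eq hII _ _ hx, conormal]

theorem hasDiracPart_Phi01 (hII : M.TypeII) : M.HasDiracPart M.Phi01 0 := by
  refine ((hasSingularPart_tfRicciC hII contDiffOn_l contDiffOn_m).smul
    _).hasDiracPart fun x hx => ?_
  simp [Fin.sum_univ_four, l_wall _ hx, m_wall _ hx, tfRicciSing_eq hII _ _ hx,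
    ricciSing_eq hII _ _ hx, conormal]

theorem hasDiracPart_Phi10 (hII : M.TypeII) : M.HasDiracPart M.Phi10 0 := by
  refine ((hasSingularPart_tfRicciC hII contDiffOn_l contDiffOn_mb).smul
    _).hasDiracPart fun x hx => ?_
  simp [Fin.sum_univ_four, l_wall _ hx, mb_wall _ hx, tfRicciSing_eq hII _ _ hx,
    ricciSing_eq hII _ _ hx, conormal]

theorem hasDiracPart_Phi02 (hII : M.TypeII) : M.HasDiracPart M.Phi02 0 := by
  refine ((hasSingularPart_tfRicciC hII contDiffOn_m contDiffOn_m).smul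
    _).hasDiracPart fun x hx => ?_
  simp [Fin.sum_univ_four, m_wall _ hx, tfRicciSing_eq hII _ _ hx,
    ricciSing_eq hII _ _ hx, conormal]

theorem hasDiracPart_Phi20 (hII : M.TypeII) : M.HasDiracPart M.Phi20 0 := by
  refine ((hasSingularPart_tfRicciC hII contDiffOn_mb contDiffOn_mb).smul
    _).hasDiracPart fun x hx => ?_
  simp [Fin.sum_univ_four, mb_wall _ hx, tfRicciSing_eq hII _ _ hx,
    ricciSing_eq hII _ _ hx, conormal]

theorem hasDiracPart_Phi11 (hII : M.TypeII) : M.HasDiracPart M.Phi11 0 := by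
  refine (((hasSingularPart_tfRicciC hII contDiffOn_l (contDiffOn_n hII)).add
    (hasSingularPart_tfRicciC hII contDiffOn_m contDiffOn_mb)).smul _).hasDiracPart
      fun x hx => ?_
  simp [Fin.sum_univ_four, l_wall _ hx, n_wall _ hx, m_wall _ hx, mb_wall _ hx,
    tfRicciSing_eq hII _ _ hx, ricciSing_eq hII _ _ hx, conormal, gJump_zero_zero hx]

theorem hasDiracPart_Phi12 (hII : M.TypeII) : M.HasDiracPart M.Phi12 
    (fun x => -jump (fun s y => conj (M.alpha s y)) x) := by
  refine ((hasSingularPart_tfRicciC hII (contDiffOn_n hII) contDiffOn_m).smul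
    _).hasDiracPart fun x hx => ?_
  simp [Fin.sum_univ_four, n_wall _ hx, m_wall _ hx, tfRicciSing_eq hII _ _ hx,
    ricciSing_eq hII _ _ hx, conormal, jump_conj_alpha, jump_alpha hII hx, gJumpLMb, map_ofNat]
  ring

theorem hasDiracPart_Phi21 (hII : M.TypeII) : M.HasDiracPart M.Phi21 (fun x => -jump M.alpha x) := by
  refine ((hasSingularPart_tfRicciC hII (contDiffOn_n hII) contDiffOn_mb).smul
    _).hasDiracPart fun x hx => ?_
  simp [Fin.sum_univ_four, n_wall _ hx, mb_wall _ hx, tfRicciSing_eq hII _ _ hx,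
    ricciSing_eq hII _ _ hx, conormal, jump_alpha hII hx, gJumpLMb]
  ring

theorem hasDiracPart_Phi22 (hII : M.TypeII) : M.HasDiracPart M.Phi22 (fun x => -jump M.mu x) := by
  refine ((hasSingularPart_tfRicciC hII (contDiffOn_n hII) (contDiffOn_n hII)).smul
    _).hasDiracPart fun x hx => ?_
  simp [Fin.sum_univ_four, n_wall _ hx, tfRicciSing_eq hII _ _ hx,
    ricciSing_eq hII _ _ hx, conormal, jump_mu hII hx]
  ring

theorem hasDiracPart_Lambda (hII : M.TypeII) : M.HasDiracPart M.Lambda 0 :=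
  ((hasSingularPart_scal hII).smul _).neg.hasDiracPart fun x hx => by
    simp [scalSing_eq hII hx]

/-! ### Geometries of type III -/

theorem typeIII_iff (hII : M.TypeII) : M.TypeIII ↔ ∀ x ∈ M.N0, jump M.alpha x = 0 := by
  have hchr : ∀ a b x, ((M.chr .plus a 0 b x - M.chr .minus a 0 b x : ℝ) : ℂ) =
      M.chrJump a 0 b x := fun a b x => by simp [chrJump, jump]
  have hdiff : ∀ (y : Fin 2 → ℝ) (X : ℝ → Coord) (t : ℝ) (a : Fin 4),
      M.genCovDeriv .plus y X t a - M.genCovDeriv .minus y X t a =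
        ∑ b, (M.chr .plus a 0 b ![t, 0, y 0, y 1] - M.chr .minus a 0 b ![t, 0, y 0, y 1])
          * X t b := fun y X t a => by
    simp only [genCovDeriv, sub_mul, Finset.sum_sub_distrib]
    ring
  constructor
  · rintro ⟨-, h⟩ x hx
    rw [jump_alpha_eq_zero_iff hII hx]
    have hxy : ![x 0, 0, (![x 2, x 3] : Fin 2 → ℝ) 0, (![x 2, x 3] : Fin 2 → ℝ) 1] = x := by
      funext i
      fin_cases i
      · rfl
      · exact hx.2.symm
      · rfl
      · rfl
    -- Transport of the constant coordinate field `∂_A` along the generator through `x`.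
    have key : ∀ A : Fin 4, A ≠ 1 → M.chrJump 0 0 A x = 0 := fun A hA => by
      have h1 := h ![x 2, x 3] (fun _ => Pi.single A 1) (differentiable_const _)
        (fun _ => by simp [hA.symm]) (x 0) (by rw [hxy]; exact hx)
      have h2 := hdiff ![x 2, x 3] (fun _ => Pi.single A 1) (x 0) 0
      rw [h1, sub_self, hxy] at h2
      simp only [Pi.single_apply, mul_ite, mul_one, mul_zero, Finset.sum_ite_eq',
        Finset.mem_univ, if_true] at h2
      rw [← hchr, ← h2, Complex.ofReal_zero]
    have h2 := key 2 (by decide)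
    have h3 := key 3 (by decide)
    simp only [chrJump_zero hII _ _ hx] at h2 h3
    simpa [conormal, Q_ne_zero hx] using And.intro h2 h3
  · refine fun h => ⟨hII, fun y X _ hX t ht => ?_⟩
    funext a
    rw [← sub_eq_zero, hdiff]
    obtain ⟨h2, h3⟩ := (jump_alpha_eq_zero_iff hII ht).1 (h _ ht)
    have key : ∀ b : Fin 4, b ≠ 1 →
        M.chr .plus a 0 b ![t, 0, y 0, y 1] - M.chr .minus a 0 b ![t, 0, y 0, y 1] = 0 := by
      intro b hb
      have h0 : M.gJump 0 b ![t, 0, y 0, y 1] = 0 := by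
        fin_cases b
        · exact gJump_zero_zero ht
        · exact absurd rfl hb
        · exact h2
        · exact h3
      rw [← Complex.ofReal_eq_zero, hchr, chrJump_eq hII _ _ _ ht]
      simp [conormal, hb, h0]
    simp [Fin.sum_univ_four, key 0 (by decide), key 2 (by decide), key 3 (by decide), hX t]

theorem TypeIII.hasDiracPart_zero (h : M.TypeIII) :
    M.HasDiracPart M.Psi3 0 ∧ M.HasDiracPart M.Phi12 0 ∧ M.HasDiracPart M.Phi21 0 := by
  have hα := (typeIII_iff h.1).1 h
  refine ⟨(hasDiracPart_Psi3 h.1).congr fun x hx => ?_,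
    (hasDiracPart_Phi12 h.1).congr fun x hx => ?_,
    (hasDiracPart_Phi21 h.1).congr fun x hx => ?_⟩
  · simp [hα x hx]
  · simp [jump_conj_alpha, hα x hx]
  · simp [hα x hx]

theorem PlaneSymmetric.typeIII (hII : M.TypeII) (h : M.PlaneSymmetric) : M.TypeIII := by
  refine (typeIII_iff hII).2 fun x hx => (jump_alpha_eq_zero_iff hII hx).2 ?_
  have hg : ∀ s, ∀ A : Fin 4, A ≠ 1 → pd s (M.g s 0 A) 1 x = 0 := fun s A hA => by
    rw [← pd_zero_fun s 1 x]
    refine pd_eq_of_eqOn M.isOpen_Ω (fun y hy => ?_) 1 (mem_part_of_mem_N0 hx s)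
    have hC := fun B => (h s).1 B y hy
    rw [← Complex.ofReal_inj, g_ofReal]
    fin_cases A
    · simp [lLow, mLow, hC]
    · exact absurd rfl hA
    · simp [lLow, nLow, mLow, hC]
    · simp [lLow, nLow, mLow, hC]
  simp [gJump, jump, hg _ 2 (by decide), hg _ 3 (by decide)]

/-! ### Pure gravitational radiation -/

theorem PureGravitationalRadiation.jump_eq_zero (hII : M.TypeII)
    (h : M.PureGravitationalRadiation) {x : Coord} (hx : x ∈ M.N0) :
    jump M.mu x = 0 ∧ jump M.alpha x = 0 := by
  have key : ∀ a b, M.ricciSing a b x = 0 := fun a b => by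
    rw [← tfRicciSing_eq hII _ _ hx]
    exact (hasSingularPart_tfRicci hII a b).eq_zero (h a b) hx
  have hQ := Q_ne_zero hx
  refine ⟨?_, ?_⟩
  · have h11 := key 1 1
    rw [ricciSing_eq hII _ _ hx] at h11
    have h0 : M.gJumpM x = 0 := by
      simp only [conormal, if_true] at h11
      linear_combination h11
    rw [jump_mu hII hx, h0]
    simp
  · rw [jump_alpha_eq_zero_iff hII hx]
    have h2 := key 1 2
    have h3 := key 1 3
    rw [ricciSing_eq hII _ _ hx] at h2 h3
    simpa [conormal, hQ] using And.intro h2 h3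

end Spacetime

end NullJump

end

open NullJump in
open scoped ComplexConjugate in
theorem theorem3 (M : NullJump.Spacetime) (hII : M.TypeII) :
    (M.HasDiracPart M.Psi4 (fun x => -jump M.lam x) ∧
      M.HasDiracPart M.Psi3 (fun x => -jump M.alpha x) ∧
      M.HasDiracPart M.Phi22 (fun x => -jump M.mu x) ∧
      M.HasDiracPart M.Phi12 (fun x => -jump (fun s y => conj (M.alpha s y)) x) ∧
      M.HasDiracPart M.Phi21 (fun x => -jump M.alpha x) ∧
      M.HasDiracPart M.Phi00 0 ∧ M.HasDiracPart M.Phi10 0 ∧ M.HasDiracPart M.Phi01 0 ∧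
      M.HasDiracPart M.Phi20 0 ∧ M.HasDiracPart M.Phi02 0 ∧ M.HasDiracPart M.Phi11 0 ∧
      M.HasDiracPart M.Lambda 0 ∧
      M.HasDiracPart M.Psi2 0 ∧ M.HasDiracPart M.Psi1 0 ∧ M.HasDiracPart M.Psi0 0) ∧
    (M.TypeIII ↔ ∀ x ∈ M.N0, jump M.alpha x = 0) ∧
    (M.TypeIII →
      M.HasDiracPart M.Psi3 0 ∧ M.HasDiracPart M.Phi12 0 ∧ M.HasDiracPart M.Phi21 0) ∧
    (M.PlaneSymmetric → M.TypeIII ∧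
      M.HasDiracPart M.Psi3 0 ∧ M.HasDiracPart M.Phi12 0 ∧ M.HasDiracPart M.Phi21 0) ∧
    (M.PureGravitationalRadiation →
      ∀ x ∈ M.N0, jump M.mu x = 0 ∧ jump M.alpha x = 0) :=
  ⟨⟨Spacetime.hasDiracPart_Psi4 hII, Spacetime.hasDiracPart_Psi3 hII,
    Spacetime.hasDiracPart_Phi22 hII, Spacetime.hasDiracPart_Phi12 hII,
    Spacetime.hasDiracPart_Phi21 hII, Spacetime.hasDiracPart_Phi00 hII,
    Spacetime.hasDiracPart_Phi10 hII, Spacetime.hasDiracPart_Phi01 hII,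
    Spacetime.hasDiracPart_Phi20 hII, Spacetime.hasDiracPart_Phi02 hII,
    Spacetime.hasDiracPart_Phi11 hII, Spacetime.hasDiracPart_Lambda hII,
    Spacetime.hasDiracPart_Psi2 hII, Spacetime.hasDiracPart_Psi1 hII,
    Spacetime.hasDiracPart_Psi0 hII⟩,
    Spacetime.typeIII_iff hII, fun h => h.hasDiracPart_zero,
    fun h => ⟨h.typeIII hII, (h.typeIII hII).hasDiracPart_zero⟩,
    fun h _ hx => h.jump_eq_zero hII hx⟩
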